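/- Let $\mathbb K$ be a field. All graded vector spaces are over $\mathbb K$; elements of a graded vector space $V$ are understood to be homogeneous. A relation $\searrow$ on $V$ is called \emph{bilinear} if there is a graded vector subspace $R\subseteq V\otimes V$ such that, for all $v,w\in V$, $v\searrow w$ if and only if $v\otimes w\in R$. The bilinear relation \emph{generated} by a relation $\nearrow$ on $V$ is the smallest bilinear relation containing $\nearrow$ (the intersection of all bilinear relations containing it). A \emph{directional graded vector space} is a graded vector space $V$ with a bilinear relation $\searrow_V$, its \emph{pointing relation}; a \emph{morphism} $V\to W$ is a degree-$0$ linear map $f$ such that $v\searrow_V v'$ implies $f(v)\searrow_W f(v')$. The tensor product $V\otimes W$ of two directional graded vector spaces is given the pointing relation defined by the graded vector subspace $$\langle v\otimes w\otimes v'\otimes w' \mid v\searrow_V v',\ w\searrow_W w'\rangle\subseteq (V\otimes W)\otimes(V\otimes W).$$ A \emph{preordered space} is a topological space $X$ with a preorder $\preceq_X$ (no compatibility is required); the product $X\times Y$ carries the product topology and the componentwise preorder. The \emph{homology digraph} of $X$ is the singular homology $H_*(X)=H_*(X;\mathbb K)$ with the pointing relation generated by the following relation: $\alpha\nearrow_X\beta$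 if there are subspaces $E,F\subseteq X$ such that $\alpha\in\operatorname{im}(H_*(E)\to H_*(X))$, $\beta\in\operatorname{im}(H_*(F)\to H_*(X))$, and $x\preceq_X y$ for all $x\in E$ and $y\in F$. \textbf{Theorem.} For all preordered spaces $X$ and $Y$, the homology cross product $$\times\colon H_*(X)\otimes H_*(Y)\to H_*(X\times Y),\qquad \alpha\otimes\beta\mapsto\alpha\times\beta,$$ is an isomorphism of directional graded vector spaces: it is a morphism of directional graded vector spaces, and it has a two-sided inverse that is also a morphism of directional graded vector spaces. -/

import Mathlib

universe u

noncomputable section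

namespace HomologyDigraph

open CategoryTheory AlgebraicTopology
open scoped DirectSum TensorProduct

/-!
### Lattice paths

A `(p, q)`-shuffle is given by a `p`-element subset `μ` of `{0, …, p + q - 1}`. It corresponds to
the monotone lattice path from `(0, 0)` to `(p, q)` whose `i`-th step is horizontal if `i ∈ μ` and
vertical otherwise. The sign of the shuffle is `(-1)` to the number of pairs `i < j` with `i ∉ μ`
and `j ∈ μ`, i.e. `(-1) ^ ∑ j ∈ μ, pathY μ j`.

This section proves the boundary formula for the sum of all lattice paths, which is what makes the
cross product of chains compatible with the differentials. Chains are here formal combinations of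
lists of vertices, listed from the last vertex to the first one.
-/
section Combi
variable (K : Type u) [Field K]

/-- The first coordinate of the `k`-th vertex of the lattice path of `μ`. -/
def pathX (μ : Finset ℕ) (k : ℕ) : ℕ := (μ ∩ Finset.range k).card
/-- The second coordinate of the `k`-th vertex of the lattice path of `μ`. -/
def pathY (μ : Finset ℕ) (k : ℕ) : ℕ := (Finset.range k \ μ).card

/-- Formal combinations of lists of vertices. -/
abbrev VC := List (ℕ × ℕ) →₀ K
variable {K}
/-- Adding a new last vertex. -/
def cone (v : ℕ × ℕ) : VC K →ₗ[K] VC K := Finsupp.lmapDomain K K (List.cons v)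

/-- The boundary of a list of vertices, with signs counted from the last vertex. -/
def bdL : List (ℕ × ℕ) → VC K
  | [] => 0
  | v :: l => Finsupp.single l 1 - cone v (bdL l)

/-- The boundary map on formal combinations of lists of vertices. -/
def bd : VC K →ₗ[K] VC K := Finsupp.linearCombination K bdL

theorem bd_cone (v : ℕ × ℕ) (c : VC K) : bd (cone v c) = c - cone v (bd c) := by
  induction c using Finsupp.induction_linear with
  | zero => simp
  | add f g hf hg => simp only [map_add, hf, hg]; abel
  | single l a =>
    simp [cone, bd, bdL, smul_sub]

/-- The `i`-th coface map on the natural numbers. -/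
def cf (i k : ℕ) : ℕ := if k < i then k else k + 1

/-- The `i`-th coface map in the first coordinate. -/
def cofX (i : ℕ) : VC K →ₗ[K] VC K := Finsupp.lmapDomain K K (List.map fun v => (cf i v.1, v.2))
/-- The `i`-th coface map in the second coordinate. -/
def cofY (i : ℕ) : VC K →ₗ[K] VC K := Finsupp.lmapDomain K K (List.map fun v => (v.1, cf i v.2))

theorem cofX_cone (i : ℕ) (v : ℕ × ℕ) (c : VC K) :
    cofX i (cone v c) = cone (cf i v.1, v.2) (cofX i c) := by
  induction c using Finsupp.induction_linear with
  | zero => simp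
  | add f g hf hg => simp only [map_add, hf, hg]
  | single l a => simp [cone, cofX]

theorem cofY_cone (i : ℕ) (v : ℕ × ℕ) (c : VC K) :
    cofY i (cone v c) = cone (v.1, cf i v.2) (cofY i c) := by
  induction c using Finsupp.induction_linear with
  | zero => simp
  | add f g hf hg => simp only [map_add, hf, hg]
  | single l a => simp [cone, cofY]

variable (K) in
/-- `J (p + 1) (q + 1)` is the signed sum of all lattice paths from `(0, 0)` to `(p, q)`, by
recursion on the last step. -/
def J : ℕ → ℕ → VC K
  | 0, _ => 0
  | _ + 1, 0 => 0
  | P + 1, Q + 1 => cone (P, Q) ((if P = 0 ∧ Q = 0 then Finsupp.single [] 1 else 0) +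
      (-1 : K) ^ Q • J P (Q + 1) + J (P + 1) Q)

theorem J_zero_right (P : ℕ) : J K P 0 = 0 := by cases P <;> simp [J]
theorem J_zero_left (P : ℕ) : J K 0 P = 0 := by simp [J]

/-- The correction term of the boundary formula in degree `0`. -/
def E (P Q : ℕ) : VC K := if P = 0 ∧ Q = 0 then Finsupp.single [] 1 else 0

theorem cofX_J_top (P Q i : ℕ) (hi : P ≤ i) : cofX i (J K P Q) = J K P Q := by
  induction P, Q using J.induct with
  | case1 => simp [J]
  | case2 => simp [J]
  | case3 P Q ih1 ih2 =>
    rw [J, cofX_cone, map_add (cofX i), map_add (cofX i), map_smul, ih1 (by omega), ih2 (by omega)]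
    have : cofX i (if P = 0 ∧ Q = 0 then Finsupp.single [] (1:K) else 0) = 
        (if P = 0 ∧ Q = 0 then Finsupp.single [] (1:K) else 0) := by
      split_ifs <;> simp [cofX]
    rw [this]
    simp [cf, show P < i by omega]

theorem cofY_J_top (P Q i : ℕ) (hi : Q ≤ i) : cofY i (J K P Q) = J K P Q := by
  induction P, Q using J.induct with
  | case1 => simp [J]
  | case2 => simp [J]
  | case3 P Q ih1 ih2 =>
    rw [J, cofY_cone, map_add (cofY i), map_add (cofY i), map_smul, ih1 (by omega), ih2 (by omega)]
    have : cofY i (if P = 0 ∧ Q = 0 then Finsupp.single [] (1:K) else 0) = 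
        (if P = 0 ∧ Q = 0 then Finsupp.single [] (1:K) else 0) := by
      split_ifs <;> simp [cofY]
    rw [this]
    simp [cf, show Q < i by omega]

/-- Alternating sum of the cofaces of `J` in the first coordinate. -/
def DX (P Q : ℕ) : VC K := ∑ i ∈ Finset.range (P + 1), (-1 : K) ^ (P + i) • cofX i (J K P Q)
/-- Alternating sum of the cofaces of `J` in the second coordinate. -/
def DY (P Q : ℕ) : VC K := ∑ i ∈ Finset.range (Q + 1), (-1 : K) ^ (Q + i) • cofY i (J K P Q)

theorem cofX_J (P Q i : ℕ) (hi : i ≤ P) : cofX i (J K (P + 1) (Q + 1)) =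
    cone (P + 1, Q) (E P Q + (-1 : K) ^ Q • cofX i (J K P (Q + 1)) + cofX i (J K (P + 1) Q)) := by
  rw [J, cofX_cone, map_add (cofX i), map_add (cofX i), map_smul]
  have : cofX i (if P = 0 ∧ Q = 0 then Finsupp.single [] (1:K) else 0) = E P Q := by
      unfold E; split_ifs <;> simp [cofX]
  rw [this]
  simp [cf, show ¬ P < i by omega]

theorem cofY_J (P Q i : ℕ) (hi : i ≤ Q) : cofY i (J K (P + 1) (Q + 1)) =
    cone (P, Q + 1) (E P Q + (-1 : K) ^ Q • cofY i (J K P (Q + 1)) + cofY i (J K (P + 1) Q)) := by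
  rw [J, cofY_cone, map_add (cofY i), map_add (cofY i), map_smul]
  have : cofY i (if P = 0 ∧ Q = 0 then Finsupp.single [] (1:K) else 0) = E P Q := by
      unfold E; split_ifs <;> simp [cofY]
  rw [this]
  simp [cf, show ¬ Q < i by omega]

/-- `DX P (Q+1)` splits off its last term. -/
theorem DX_succ (P Q : ℕ) : DX (K := K) (P + 1) (Q + 1) = J K (P + 1) (Q + 1) -
    cone (P + 1, Q) (E P Q + (-1 : K) ^ Q • DX P (Q + 1) + (J K (P + 1) Q - DX (P + 1) Q)) := by
  have h1 : ∀ Q, DX (K := K) (P + 1) Q = J K (P + 1) Q -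
      ∑ i ∈ Finset.range (P + 1), (-1 : K) ^ (P + i) • cofX i (J K (P + 1) Q) := by
    intro Q
    rw [DX, Finset.sum_range_succ, cofX_J_top _ _ _ le_rfl, ← two_mul, pow_mul]
    simp only [neg_one_sq, one_pow, one_smul]
    rw [add_comm, sub_eq_add_neg, ← Finset.sum_neg_distrib]
    congr 1
    refine Finset.sum_congr rfl fun i _ => ?_
    rw [← neg_smul]; congr 1; ring
  rw [h1 (Q + 1), h1 Q, sub_sub_cancel]
  congr 1
  have h2 : ∑ i ∈ Finset.range (P + 1), (-1 : K) ^ (P + i) • E (K := K) P Q = E P Q := by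
    unfold E
    split_ifs with h
    · rw [h.1]; simp
    · simp
  conv_rhs => rw [← h2, DX]
  simp only [map_add, map_smul, map_sum, Finset.smul_sum]
  rw [← Finset.sum_add_distrib, ← Finset.sum_add_distrib]
  refine Finset.sum_congr rfl fun i hi => ?_
  rw [cofX_J _ _ _ (by simp at hi; omega)]
  simp only [map_add, map_smul, smul_add]
  rw [smul_comm]

theorem DY_succ (P Q : ℕ) : DY (K := K) (P + 1) (Q + 1) = J K (P + 1) (Q + 1) -
    cone (P, Q + 1) (E P Q + (-1 : K) ^ Q • (J K P (Q + 1) - DY P (Q + 1)) + DY (P + 1) Q) := by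
  have h1 : ∀ P, DY (K := K) P (Q + 1) = J K P (Q + 1) -
      ∑ i ∈ Finset.range (Q + 1), (-1 : K) ^ (Q + i) • cofY i (J K P (Q + 1)) := by
    intro P
    rw [DY, Finset.sum_range_succ, cofY_J_top _ _ _ le_rfl, ← two_mul, pow_mul]
    simp only [neg_one_sq, one_pow, one_smul]
    rw [add_comm, sub_eq_add_neg, ← Finset.sum_neg_distrib]
    congr 1
    refine Finset.sum_congr rfl fun i _ => ?_
    rw [← neg_smul]; congr 1; ring
  rw [h1 (P + 1), h1 P, sub_sub_cancel]
  congr 1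
  have h2 : ∑ i ∈ Finset.range (Q + 1), (-1 : K) ^ (Q + i) • E (K := K) P Q = E P Q := by
    unfold E
    split_ifs with h
    · rw [h.2]; simp
    · simp
  conv_rhs => rw [← h2, DY]
  simp only [map_add, map_smul, map_sum, Finset.smul_sum]
  rw [← Finset.sum_add_distrib, ← Finset.sum_add_distrib]
  refine Finset.sum_congr rfl fun i hi => ?_
  rw [cofY_J _ _ _ (by simp at hi; omega)]
  simp only [map_add, map_smul, smul_add]
  rw [smul_comm]

theorem DX_zero_left (Q : ℕ) : DX (K := K) 0 Q = 0 := by simp [DX, J]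
theorem DX_zero_right (P : ℕ) : DX (K := K) P 0 = 0 := by simp [DX, J_zero_right]
theorem DY_zero_left (Q : ℕ) : DY (K := K) 0 Q = 0 := by simp [DY, J]
theorem DY_zero_right (P : ℕ) : DY (K := K) P 0 = 0 := by simp [DY, J_zero_right]

theorem bd_J (P Q : ℕ) : bd (J K (P + 1) (Q + 1)) =
    E P Q + (-1 : K) ^ Q • DX P (Q + 1) + DY (P + 1) Q := by
  have key : ∀ n P Q, P + Q = n → bd (J K (P + 1) (Q + 1)) =
    E P Q + (-1 : K) ^ Q • DX P (Q + 1) + DY (P + 1) Q := by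
    intro n
    induction n using Nat.strong_induction_on with
    | _ n ih =>
      intro P Q hn
      have hq : ((-1 : K) ^ Q) * (-1) ^ Q = 1 := by rw [← mul_pow]; simp
      rw [J, bd_cone]
      change E P Q + _ + _ - cone _ (bd (E P Q + _ + _)) = _
      have hE : bd (E (K := K) P Q) = 0 := by unfold E; split_ifs <;> simp [bd, bdL]
      rw [map_add bd, map_add bd, hE, map_smul]
      rcases P with _ | P <;> rcases Q with _ | Q
      · simp [J_zero_right, J_zero_left, DX_zero_left, DY_zero_right]
      · rw [ih (0 + Q) (by omega) 0 Q rfl, DY_succ]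
        simp [J_zero_right, J_zero_left, DX_zero_left, DY_zero_left, E, map_add]
      · rw [ih (P + 0) (by omega) P 0 (by omega), DX_succ]
        simp [J_zero_right, J_zero_left, DX_zero_right, DY_zero_right, E, map_add]
      · rw [ih (P + (Q + 1)) (by omega) P (Q + 1) (by omega), ih (P + 1 + Q) (by omega) (P + 1) Q (by omega),
          DX_succ P (Q + 1), DY_succ (P + 1) Q]
        have e1 : E (K := K) (P + 1) (Q + 1) = 0 := by simp [E]
        have e2 : E (K := K) (P + 1) (Q) = 0 := by simp [E]
        have e3 : E (K := K) (P) (Q + 1) = 0 := by simp [E]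
        rw [e1, e2, e3]
        simp only [zero_add, map_add, map_sub, map_smul, smul_add, smul_sub, smul_smul, hq, one_smul]
        have h3 : (-1 : K) ^ (Q + 1) = - (-1) ^ Q := by ring
        have h4 : (-1 : K) ^ Q * (-1) ^ Q = 1 := by rw [← mul_pow]; simp
        simp only [h3, neg_mul, mul_neg, neg_smul, h4, one_smul, neg_neg]
        abel
  exact key _ P Q rfl

/-- The list of the vertices of the lattice path of `μ`, from the last one to the first one. -/
def plist (μ : Finset ℕ) : ℕ → List (ℕ × ℕ)
  | 0 => [(pathX μ 0, pathY μ 0)]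
  | k + 1 => (pathX μ (k + 1), pathY μ (k + 1)) :: plist μ k

theorem plist_congr (μ ν : Finset ℕ) (n : ℕ) (h : μ ∩ Finset.range n = ν ∩ Finset.range n) :
    plist μ n = plist ν n := by
  have hx : ∀ k ≤ n, pathX μ k = pathX ν k ∧ pathY μ k = pathY ν k := by
    intro k hk
    have hm : ∀ i < k, (i ∈ μ ↔ i ∈ ν) := by
      intro i hi
      have := congrArg (fun s => i ∈ s) h
      simpa [show i < n by omega] using this
    constructor
    · unfold pathX; congr 1; ext i; simp; grind
    · unfold pathY; congr 1; ext i; simp; grind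
  clear h
  induction n with
  | zero => simp [plist, hx]
  | succ n ih => rw [plist, plist, ih (fun k hk => hx k (by omega)), (hx (n+1) le_rfl).1, (hx (n+1) le_rfl).2]

theorem path_card {μ : Finset ℕ} {n : ℕ} (h : μ ⊆ Finset.range n) :
    pathX μ n = μ.card ∧ pathY μ n = n - μ.card := by
  constructor
  · rw [pathX, Finset.inter_eq_left.2 h]
  · rw [pathY, Finset.card_sdiff_of_subset h, Finset.card_range]

variable (K) in
/-- The signed sum of the lattice paths of all `p`-element subsets of `{0, …, n - 1}`. -/
def S (p n : ℕ) : VC K :=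
  ∑ μ ∈ Finset.powersetCard p (Finset.range n),
    (-1 : K) ^ (∑ j ∈ μ, pathY μ j) • Finsupp.single (plist μ n) 1

theorem S_empty (p n : ℕ) (h : n < p) : S K p n = 0 := by
  rw [S, Finset.powersetCard_eq_empty.2 (by simpa using h), Finset.sum_empty]

theorem sum_cons (p q n : ℕ) (h : p + q = n + 1) :
    ∑ μ ∈ Finset.powersetCard p (Finset.range n),
    (-1 : K) ^ (∑ j ∈ μ, pathY μ j) • Finsupp.single (plist μ (n + 1)) (1 : K) =
      cone (p, q) (S K p n) := by
  simp only [S, map_sum, map_smul]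
  refine Finset.sum_congr rfl fun μ hμ => ?_
  rw [Finset.mem_powersetCard] at hμ
  have h1 := path_card (hμ.1.trans (Finset.range_mono (Nat.le_succ n)))
  rw [hμ.2] at h1
  rw [plist, h1.1, h1.2, show n + 1 - p = q by omega]
  simp [cone]

theorem S_succ (p q n : ℕ) (h : p + 1 + q = n + 1) : S K (p + 1) (n + 1) =
    cone (p + 1, q) ((-1 : K) ^ q • S K p n + S K (p + 1) n) := by
  conv_lhs => rw [S, Finset.range_add_one, Finset.powersetCard_succ_insert (by simp)]
  rw [Finset.sum_union, sum_cons (p + 1) q n h, add_comm, map_add, map_smul]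
  · congr 1
    rw [Finset.sum_image]
    · simp only [S, map_sum, map_smul, Finset.smul_sum]
      refine Finset.sum_congr rfl fun μ hμ => ?_
      rw [Finset.mem_powersetCard] at hμ
      have hn : n ∉ μ := fun hh => by simpa using hμ.1 hh
      have hY : ∀ k ≤ n, pathY (insert n μ) k = pathY μ k := by
        intro k hk
        unfold pathY; congr 1; ext i; simp; grind
      have h1 := path_card (μ := insert n μ) (n := n + 1)
        (by rw [Finset.range_add_one]; exact Finset.insert_subset_insert _ hμ.1)
      have h2 := path_card hμ.1
      rw [Finset.card_insert_of_notMem hn, hμ.2] at h1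
      rw [plist, h1.1, h1.2, plist_congr (insert n μ) μ n (by rw [Finset.insert_inter_of_notMem (by simp)]),
        Finset.sum_insert hn, hY n le_rfl, h2.2, hμ.2, show n + 1 - (p + 1) = q by omega,
        show n - p = q by omega, pow_add, mul_smul]
      have : ∑ j ∈ μ, pathY (insert n μ) j = ∑ j ∈ μ, pathY μ j :=
        Finset.sum_congr rfl fun j hj => hY j (by have := hμ.1 hj; simp at this; omega)
      rw [this]
      simp [cone]
    · intro μ hμ ν hν hh
      rw [Finset.mem_coe, Finset.mem_powersetCard] at hμ hν
      have hn : n ∉ μ := fun hh => by simpa using hμ.1 hh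
      have hn' : n ∉ ν := fun hh => by simpa using hν.1 hh
      simpa [Finset.erase_insert hn, Finset.erase_insert hn'] using congrArg (Finset.erase · n) hh
  · rw [Finset.disjoint_left]
    intro μ hμ hμ'
    rw [Finset.mem_powersetCard] at hμ
    obtain ⟨ν, -, rfl⟩ := Finset.mem_image.1 hμ'
    simpa using hμ.1 (Finset.mem_insert_self n ν)

theorem S_zero_succ (n : ℕ) : S K 0 (n + 1) = cone (0, n + 1) (S K 0 n) := by
  rw [← sum_cons 0 (n + 1) n (by omega), S]; simp

theorem J_eq_S (p q n : ℕ) (h : p + q = n) : J K (p + 1) (q + 1) = S K p n := by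
  induction n generalizing p q with
  | zero =>
    obtain rfl : p = 0 := by omega
    obtain rfl : q = 0 := by omega
    simp [J, S, plist, pathX, pathY, cone]
  | succ n ih =>
    rw [J, if_neg (by omega), zero_add]
    rcases p with _ | p
    · obtain rfl : q = n + 1 := by omega
      rw [S_zero_succ, J_zero_left, smul_zero, zero_add, ih 0 n (by omega)]
    · rw [S_succ p q n h, ih p q (by omega)]
      rcases q with _ | q
      · rw [J_zero_right, S_empty (p + 1) n (by omega)]
      · rw [ih (p + 1) q (by omega)]
end Combi
/-! ### Singular chains and the cross product of chains -/

section Chains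
variable (K : Type u) [Field K] (X : Type u) [TopologicalSpace X]

/-- The singular chain complex of a space, with coefficients in the field `K`. -/
abbrev singularChains : ChainComplex (ModuleCat.{u} K) ℕ :=
  ((singularChainComplexFunctor (ModuleCat.{u} K)).obj (ModuleCat.of K K)).obj (TopCat.of X)

/-- Singular homology with coefficients in the field `K`. -/
abbrev SingularHomology (n : ℕ) : ModuleCat.{u} K := (singularChains K X).homology n
variable {X}
/-- The basis element of the singular chains given by a singular simplex. -/
def simplexChain {n : ℕ} (σ : C(stdSimplex ℝ (Fin (n + 1)), X)) : (singularChains K X).X n :=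
  ((TopCat.toSSet.obj (TopCat.of X)).ιChainComplex (R := ModuleCat.of K K)
    (((TopCat.of X).toSSetObjEquiv (.op (.mk n))).symm σ)).hom 1

variable {K}
/-- The linear map on singular chains with given values on singular simplices. -/
def chainLift {n : ℕ} {M : Type u} [AddCommGroup M] [Module K M]
    (g : C(stdSimplex ℝ (Fin (n + 1)), X) → M) : (singularChains K X).X n →ₗ[K] M :=
  ModuleCat.Hom.hom <| Limits.Cofan.IsColimit.desc
    ((TopCat.toSSet.obj (TopCat.of X)).isColimitChainComplexXCofan (ModuleCat.of K K) n)
    (A := ModuleCat.of K M)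
    fun x => ModuleCat.ofHom (LinearMap.toSpanSingleton K M
      (g ((TopCat.of X).toSSetObjEquiv (.op (.mk n)) x)))

theorem chainLift_simplexChain {n : ℕ} {M : Type u} [AddCommGroup M] [Module K M]
    (g : C(stdSimplex ℝ (Fin (n + 1)), X) → M) (σ : C(stdSimplex ℝ (Fin (n + 1)), X)) :
    chainLift (K := K) g (simplexChain K σ) = g σ := by
  have := Limits.Cofan.IsColimit.fac
    ((TopCat.toSSet.obj (TopCat.of X)).isColimitChainComplexXCofan (ModuleCat.of K K) n)
    (A := ModuleCat.of K M)
    (fun x => ModuleCat.ofHom (LinearMap.toSpanSingleton K M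
      (g ((TopCat.of X).toSSetObjEquiv (.op (.mk n)) x)))) 
    (((TopCat.of X).toSSetObjEquiv (.op (.mk n))).symm σ)
  have h2 := congrArg (fun f => f.hom (1 : K)) this
  refine Eq.trans h2 ?_
  simp

theorem chain_hom_ext {n : ℕ} {M : Type u} [AddCommGroup M] [Module K M]
    {f g : (singularChains K X).X n →ₗ[K] M}
    (h : ∀ σ : C(stdSimplex ℝ (Fin (n + 1)), X), f (simplexChain K σ) = g (simplexChain K σ)) : f = g := by
  have : ModuleCat.ofHom f = ModuleCat.ofHom g := by
    refine SSet.chainComplex_hom_ext fun x => ?_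
    ext
    have := h ((TopCat.of X).toSSetObjEquiv (.op (.mk n)) x)
    rw [simplexChain, Equiv.symm_apply_apply] at this
    exact this
  exact congrArg ModuleCat.Hom.hom this

/-- The inclusion of the `i`-th face of the standard simplex. -/
def faceMap (n : ℕ) (i : Fin (n + 2)) : C(stdSimplex ℝ (Fin (n + 1)), stdSimplex ℝ (Fin (n + 2))) :=
  ⟨stdSimplex.map i.succAbove, stdSimplex.continuous_map _⟩

theorem d_simplexChain {n : ℕ} (σ : C(stdSimplex ℝ (Fin (n + 2)), X)) :
    ((singularChains K X).d (n + 1) n).hom (simplexChain K σ) =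
      ∑ i : Fin (n + 2), (-1 : K) ^ (i : ℕ) • simplexChain K (σ.comp (faceMap n i)) := by
  have := SSet.ιChainComplex_d (TopCat.toSSet.obj (TopCat.of X)) (ModuleCat.of K K) 
    (((TopCat.of X).toSSetObjEquiv (.op (.mk (n+1)))).symm σ)
  have h2 := congrArg (fun f => f.hom (1 : K)) this
  refine Eq.trans h2 ?_
  simp only [ModuleCat.hom_sum, LinearMap.sum_apply]
  refine Finset.sum_congr rfl fun i _ => ?_
  have h3 : (TopCat.toSSet.obj (TopCat.of X)).δ i (((TopCat.of X).toSSetObjEquiv (.op (.mk (n+1)))).symm σ) = 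
    (((TopCat.of X).toSSetObjEquiv (.op (.mk n))).symm (σ.comp (faceMap n i))) := rfl
  rw [h3]
  have h4 : ∀ (k : ℕ) (a : (singularChains K X).X n), ((-1 : ℤ)^k) • a = ((-1 : K)^k) • a := by
    intro k a
    rcases Nat.even_or_odd k with h | h <;> simp [h.neg_one_pow]
  rw [← h4]; rfl

variable {Y : Type u} [TopologicalSpace Y]

/-- The affine map of standard simplices that sends vertex `k` to vertex `f k`. It is used for
vertex functions with `f k ≤ p` for all `k ≤ n`. -/
def vertexMap (f : ℕ → ℕ) (n p : ℕ) :
    C(stdSimplex ℝ (Fin (n + 1)), stdSimplex ℝ (Fin (p + 1))) :=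
  ⟨stdSimplex.map fun k : Fin (n + 1) => Fin.ofNat (p + 1) (f k), stdSimplex.continuous_map _⟩

variable (K) in
/-- The shuffle (Eilenberg–Zilber) product of a singular `p`-simplex of `X` and a singular
`q`-simplex of `Y`, as an `n`-chain of `X × Y`, where `n = p + q`: the signed sum over all
`(p, q)`-shuffles of the simplices `(σ ∘ μ_X, τ ∘ μ_Y)`, where `(μ_X, μ_Y)` is the lattice path of
the shuffle. (The index `n` is a separate variable only to avoid casts.) -/
def shuffleProduct {p q : ℕ} (n : ℕ) (σ : C(stdSimplex ℝ (Fin (p + 1)), X))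
    (τ : C(stdSimplex ℝ (Fin (q + 1)), Y)) : (singularChains K (X × Y)).X n :=
  ∑ μ ∈ Finset.powersetCard p (Finset.range n),
    (-1 : K) ^ (∑ j ∈ μ, pathY μ j) •
      simplexChain K ((σ.comp (vertexMap (pathX μ) n p)).prodMk (τ.comp (vertexMap (pathY μ) n q)))

variable (K) in
/-- The cross product of singular chains, in degree `n = p + q`. -/
def chainCross (p q n : ℕ) : (singularChains K X).X p →ₗ[K] (singularChains K Y).X q →ₗ[K]
    (singularChains K (X × Y)).X n :=
  chainLift fun σ => chainLift fun τ => shuffleProduct K n σ τ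

theorem cross_simplex (p q n : ℕ) (σ : C(stdSimplex ℝ (Fin (p + 1)), X))
    (τ : C(stdSimplex ℝ (Fin (q + 1)), Y)) :
    chainCross K p q n (simplexChain K σ) (simplexChain K τ) = shuffleProduct K n σ τ := by
  rw [chainCross, chainLift_simplexChain, chainLift_simplexChain]

variable (K) in
/-- The singular simplex of `X × Y` given by a list of vertices of the product of the two
simplices. -/
def evL {p q : ℕ} (n : ℕ) (σ : C(stdSimplex ℝ (Fin (p + 1)), X))
    (τ : C(stdSimplex ℝ (Fin (q + 1)), Y)) (l : List (ℕ × ℕ)) : (singularChains K (X × Y)).X n :=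
  simplexChain K ((σ.comp (vertexMap (fun k => (l[n - k]?.getD (0, 0)).1) n p)).prodMk
    (τ.comp (vertexMap (fun k => (l[n - k]?.getD (0, 0)).2) n q)))

variable (K) in
/-- The linear extension of `evL`. -/
def ev {p q : ℕ} (n : ℕ) (σ : C(stdSimplex ℝ (Fin (p + 1)), X))
    (τ : C(stdSimplex ℝ (Fin (q + 1)), Y)) : VC K →ₗ[K] (singularChains K (X × Y)).X n :=
  Finsupp.linearCombination K (evL K n σ τ)

theorem plist_get (μ : Finset ℕ) (n k : ℕ) (h : k ≤ n) :
    (plist μ n)[n - k]? = some (pathX μ k, pathY μ k) := by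
  induction n with
  | zero => obtain rfl : k = 0 := by omega
            simp [plist]
  | succ n ih =>
    rw [plist]
    rcases Nat.lt_or_eq_of_le h with h | rfl
    · rw [show n + 1 - k = (n - k) + 1 by omega, List.getElem?_cons_succ, ih (by omega)]
    · simp

theorem plist_length (μ : Finset ℕ) (n : ℕ) : (plist μ n).length = n + 1 := by
  induction n with
  | zero => simp [plist]
  | succ n ih => simp [plist, ih]

theorem plist_mem (μ : Finset ℕ) (n : ℕ) (v : ℕ × ℕ) (h : v ∈ plist μ n) :
    ∃ k ≤ n, v = (pathX μ k, pathY μ k) := by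
  induction n with
  | zero => exact ⟨0, le_rfl, by simpa [plist] using h⟩
  | succ n ih =>
    rw [plist, List.mem_cons] at h
    rcases h with rfl | h
    · exact ⟨n + 1, le_rfl, rfl⟩
    · obtain ⟨k, hk, rfl⟩ := ih h
      exact ⟨k, by omega, rfl⟩

theorem vertexMap_congr (f g : ℕ → ℕ) (n p : ℕ) (h : ∀ k ≤ n, f k = g k) :
    vertexMap f n p = vertexMap g n p := by
  unfold vertexMap
  congr 2
  funext k
  rw [h k (by omega)]

theorem ev_S {p q : ℕ} (n : ℕ) (σ : C(stdSimplex ℝ (Fin (p + 1)), X))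
    (τ : C(stdSimplex ℝ (Fin (q + 1)), Y)) : ev K n σ τ (S K p n) = shuffleProduct K n σ τ := by
  rw [S, shuffleProduct, map_sum]
  refine Finset.sum_congr rfl fun μ _ => ?_
  rw [map_smul, ev, Finsupp.linearCombination_single, one_smul, evL]
  rw [vertexMap_congr _ (pathX μ) n p fun k hk => by rw [plist_get _ _ _ hk]; rfl,
    vertexMap_congr _ (pathY μ) n q fun k hk => by rw [plist_get _ _ _ hk]; rfl]

theorem bdL_eq (l : List (ℕ × ℕ)) :
    bdL (K := K) l = ∑ i ∈ Finset.range l.length, (-1 : K) ^ i • Finsupp.single (l.eraseIdx i) 1 := by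
  induction l with
  | nil => simp [bdL]
  | cons v l ih =>
    rw [bdL, List.length_cons, Finset.sum_range_succ', ih, map_sum, sub_eq_add_neg,
      ← Finset.sum_neg_distrib, add_comm]
    congr 1
    · refine Finset.sum_congr rfl fun i _ => ?_
      rw [map_smul, ← neg_smul, pow_succ, mul_neg_one]
      simp [cone]
    · simp

theorem vertexMap_comp_faceMap (f g : ℕ → ℕ) (n p : ℕ) (i : Fin (n + 2))
    (h : ∀ k : Fin (n + 1), f (i.succAbove k) = g k) :
    (vertexMap f (n + 1) p).comp (faceMap n i) = vertexMap g n p := by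
  ext x : 1
  simp only [vertexMap, faceMap, ContinuousMap.comp_apply, ContinuousMap.coe_mk]
  rw [stdSimplex.map_comp_apply]
  congr 1
  funext k
  simp [← h]

theorem d_evL {p q : ℕ} (n : ℕ) (σ : C(stdSimplex ℝ (Fin (p + 1)), X))
    (τ : C(stdSimplex ℝ (Fin (q + 1)), Y)) (l : List (ℕ × ℕ)) (hl : l.length = n + 2) :
    ((singularChains K (X × Y)).d (n + 1) n).hom (evL K (n + 1) σ τ l) =
      (-1 : K) ^ (n + 1) • ev K n σ τ (bdL l) := by
  rw [evL, d_simplexChain, bdL_eq, hl, map_sum, ← Finset.sum_range_reflect, Finset.sum_range,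
    Finset.smul_sum]
  refine Finset.sum_congr rfl fun i _ => ?_
  rw [map_smul, smul_smul, ← pow_add, ev, Finsupp.linearCombination_single, one_smul, evL]
  have hs : (-1 : K) ^ (n + 1 + (n + 2 - 1 - (i : ℕ))) = (-1) ^ (i : ℕ) := by
    rw [show n + 1 + (n + 2 - 1 - (i : ℕ)) = 2 * (n + 1 - i) + i by omega, pow_add, pow_mul]
    simp
  have hk : ∀ k : Fin (n + 1), l[n + 1 - (i.succAbove k : ℕ)]? =
      (l.eraseIdx (n + 2 - 1 - i))[n - (k : ℕ)]? := by
    intro k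
    rw [List.getElem?_eraseIdx]
    have hk := k.2
    have hi := i.2
    by_cases h : (k : ℕ) < i
    · have : (i.succAbove k : ℕ) = k := by
        rw [Fin.succAbove_of_castSucc_lt _ _ (by simpa [Fin.lt_def] using h)]; rfl
      rw [this, if_neg (by omega)]
      congr 1; omega
    · have : (i.succAbove k : ℕ) = k + 1 := by
        rw [Fin.succAbove_of_le_castSucc _ _ (by simpa [Fin.le_def] using h)]; rfl
      rw [this, if_pos (by omega)]
      congr 1; omega
  rw [hs]
  congr 2
  rw [← vertexMap_comp_faceMap (fun k => (l[n + 1 - k]?.getD (0, 0)).1) _ n p i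
      fun k => by rw [← hk k],
    ← vertexMap_comp_faceMap (fun k => (l[n + 1 - k]?.getD (0, 0)).2) _ n q i
      fun k => by rw [← hk k]]
  rfl

theorem d_ev_S {p q : ℕ} (n : ℕ) (σ : C(stdSimplex ℝ (Fin (p + 1)), X))
    (τ : C(stdSimplex ℝ (Fin (q + 1)), Y)) :
    ((singularChains K (X × Y)).d (n + 1) n).hom (ev K (n + 1) σ τ (S K p (n + 1))) =
      (-1 : K) ^ (n + 1) • ev K n σ τ (bd (S K p (n + 1))) := by
  simp only [S, map_sum, map_smul, Finset.smul_sum]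
  refine Finset.sum_congr rfl fun μ _ => ?_
  rw [ev, Finsupp.linearCombination_single, one_smul, d_evL _ _ _ _ (plist_length _ _), bd,
    Finsupp.linearCombination_single, one_smul, smul_comm]

theorem cf_fin (p : ℕ) (i : Fin (p + 2)) (m : ℕ) (hm : m ≤ p) :
    Fin.ofNat (p + 2) (cf i m) = i.succAbove (Fin.ofNat (p + 1) m) := by
  have h1 : (Fin.ofNat (p + 1) m : ℕ) = m := Nat.mod_eq_of_lt (by omega)
  ext
  have h2 : cf i m < p + 2 := by unfold cf; split_ifs <;> omega
  change cf i m % (p + 2) = _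
  rw [Nat.mod_eq_of_lt h2]
  unfold cf
  split_ifs with h
  · rw [Fin.succAbove_of_castSucc_lt _ _ (Fin.lt_def.2 (by rw [Fin.val_castSucc, h1]; exact h))]
    exact h1.symm
  · rw [Fin.succAbove_of_le_castSucc _ _
      (Fin.le_def.2 (by rw [Fin.val_castSucc, h1]; exact not_lt.1 h)), Fin.val_succ, h1]

theorem vertexMap_cf (f g : ℕ → ℕ) (n p : ℕ) (i : Fin (p + 2)) (hf : ∀ k ≤ n, f k ≤ p)
    (hg : ∀ k ≤ n, g k = cf i (f k)) :
    vertexMap g n (p + 1) = (faceMap p i).comp (vertexMap f n p) := by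
  ext x : 1
  simp only [vertexMap, faceMap, ContinuousMap.comp_apply, ContinuousMap.coe_mk]
  rw [stdSimplex.map_comp_apply]
  congr 1
  funext k
  have hk : (k : ℕ) ≤ n := by omega
  simp only [Function.comp]
  rw [hg _ hk, cf_fin _ _ _ (hf _ hk)]

theorem ev_cofX {p q : ℕ} (n : ℕ) (σ : C(stdSimplex ℝ (Fin (p + 2)), X))
    (τ : C(stdSimplex ℝ (Fin (q + 1)), Y)) (i : Fin (p + 2)) :
    ev K n σ τ (cofX i (S K p n)) = shuffleProduct K n (σ.comp (faceMap p i)) τ := by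
  rw [← ev_S]
  simp only [S, map_sum, map_smul]
  refine Finset.sum_congr rfl fun μ hμ => ?_
  congr 1
  rw [Finset.mem_powersetCard] at hμ
  have hb : ∀ k, pathX μ k ≤ p := fun k => hμ.2 ▸ Finset.card_le_card Finset.inter_subset_left
  simp only [cofX, Finsupp.lmapDomain_apply, Finsupp.mapDomain_single, ev,
    Finsupp.linearCombination_single, one_smul, evL, List.getElem?_map]
  congr 2
  · rw [ContinuousMap.comp_assoc, ← vertexMap_cf]
    · intro k hk; rw [plist_get _ _ _ hk]; exact hb k
    · intro k hk; rw [plist_get _ _ _ hk]; rfl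
  · congr 1
    refine vertexMap_congr _ _ _ _ fun k hk => ?_
    rw [plist_get _ _ _ hk]; rfl

theorem ev_cofY {p q : ℕ} (n : ℕ) (h : p + q = n) (σ : C(stdSimplex ℝ (Fin (p + 1)), X))
    (τ : C(stdSimplex ℝ (Fin (q + 2)), Y)) (i : Fin (q + 2)) :
    ev K n σ τ (cofY i (S K p n)) = shuffleProduct K n σ (τ.comp (faceMap q i)) := by
  rw [← ev_S]
  simp only [S, map_sum, map_smul]
  refine Finset.sum_congr rfl fun μ hμ => ?_
  congr 1
  rw [Finset.mem_powersetCard] at hμ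
  have hb : ∀ k ≤ n, pathY μ k ≤ q := fun k hk => by
    have h1 : pathY μ k ≤ pathY μ n :=
      Finset.card_le_card (Finset.sdiff_subset_sdiff (Finset.range_mono hk) subset_rfl)
    rw [(path_card hμ.1).2, hμ.2] at h1
    omega
  simp only [cofY, Finsupp.lmapDomain_apply, Finsupp.mapDomain_single, ev,
    Finsupp.linearCombination_single, one_smul, evL, List.getElem?_map]
  congr 2
  · congr 1
    refine vertexMap_congr _ _ _ _ fun k hk => ?_
    rw [plist_get _ _ _ hk]; rfl
  · rw [ContinuousMap.comp_assoc, ← vertexMap_cf]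
    · intro k hk; rw [plist_get _ _ _ hk]; exact hb k hk
    · intro k hk; rw [plist_get _ _ _ hk]; rfl

theorem ev_DX {p q n : ℕ} (h : p + q = n + 1) (σ : C(stdSimplex ℝ (Fin (p + 1)), X))
    (τ : C(stdSimplex ℝ (Fin (q + 1)), Y)) : ev K n σ τ (DX p (q + 1)) =
      (-1 : K) ^ p • chainCross K (p - 1) q n (((singularChains K X).d p (p - 1)).hom (simplexChain K σ))
        (simplexChain K τ) := by
  rcases p with _ | p
  · rw [DX_zero_left, (singularChains K X).shape _ _ (by simp)]; simp
  · rw [DX, J_eq_S p q n (by omega), map_sum, Finset.sum_range]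
    change _ = (-1 : K) ^ (p + 1) • chainCross K p q n
      (((singularChains K X).d (p + 1) p).hom (simplexChain K σ)) (simplexChain K τ)
    rw [d_simplexChain, map_sum, LinearMap.sum_apply, Finset.smul_sum]
    refine Finset.sum_congr rfl fun i _ => ?_
    rw [map_smul, ev_cofX, map_smul, LinearMap.smul_apply, cross_simplex, smul_smul, pow_add]

theorem ev_DY {p q n : ℕ} (h : p + q = n + 1) (σ : C(stdSimplex ℝ (Fin (p + 1)), X))
    (τ : C(stdSimplex ℝ (Fin (q + 1)), Y)) : ev K n σ τ (DY (p + 1) q) =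
      (-1 : K) ^ q • chainCross K p (q - 1) n (simplexChain K σ)
        (((singularChains K Y).d q (q - 1)).hom (simplexChain K τ)) := by
  rcases q with _ | q
  · rw [DY_zero_right, (singularChains K Y).shape _ _ (by simp)]; simp
  · rw [DY, J_eq_S p q n (by omega), map_sum, Finset.sum_range]
    change _ = (-1 : K) ^ (q + 1) • chainCross K p q n (simplexChain K σ)
      (((singularChains K Y).d (q + 1) q).hom (simplexChain K τ))
    rw [d_simplexChain, map_sum, Finset.smul_sum]
    refine Finset.sum_congr rfl fun i _ => ?_
    rw [map_smul, ev_cofY n (by omega), map_smul, cross_simplex, smul_smul, pow_add]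

/-- The Leibniz rule `d (a × b) = d a × b + (-1) ^ p • a × d b`. Recall that `d 0 0 = 0`. -/
theorem d_cross {p q n : ℕ} (h : p + q = n + 1) (a : (singularChains K X).X p)
    (b : (singularChains K Y).X q) :
    ((singularChains K (X × Y)).d (n + 1) n).hom (chainCross K p q (n + 1) a b) =
      chainCross K (p - 1) q n (((singularChains K X).d p (p - 1)).hom a) b +
      (-1 : K) ^ p • chainCross K p (q - 1) n a (((singularChains K Y).d q (q - 1)).hom b) := by
  have key : (chainCross K p q (n + 1)).compr₂ ((singularChains K (X × Y)).d (n + 1) n).hom =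
      (chainCross K (X := X) (Y := Y) (p - 1) q n).comp ((singularChains K X).d p (p - 1)).hom +
      (-1 : K) ^ p • (chainCross K p (q - 1) n).compl₂ ((singularChains K Y).d q (q - 1)).hom := by
    refine chain_hom_ext fun σ => chain_hom_ext fun τ => ?_
    simp only [LinearMap.compr₂_apply, LinearMap.add_apply, LinearMap.smul_apply,
      LinearMap.compl₂_apply, LinearMap.comp_apply]
    have hE : E (K := K) p q = 0 := by rw [E, if_neg (by omega)]
    rw [cross_simplex, ← ev_S, d_ev_S, ← J_eq_S p q (n + 1) h, bd_J, hE, zero_add, map_add, map_smul,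
      ev_DX h, ev_DY h, ← h, smul_add, smul_smul, smul_smul, smul_smul]
    congr 2
    · have : (-1 : K) ^ (p + q) * (-1) ^ q * (-1) ^ p = 1 := by
        rw [← pow_add, ← pow_add, show p + q + q + p = 2 * (p + q) by omega, pow_mul]; simp
      rw [mul_assoc] at this ⊢; rw [this, one_smul]
    · rw [← pow_add, show p + q + q = 2 * q + p by omega, pow_add, pow_mul]; simp
  exact congrArg (fun f => f a b) key

/-! ### Passage to homology -/

section Descent
variable {A A' B B' D : Type u} [AddCommGroup A] [Module K A] [AddCommGroup A'] [Module K A']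
  [AddCommGroup B] [Module K B] [AddCommGroup B'] [Module K B'] [AddCommGroup D] [Module K D]

/-- The factorization of a linear map through a surjection whose kernel it kills. -/
def descend (π : A →ₗ[K] A') (hπ : Function.Surjective π) (f : A →ₗ[K] D)
    (h : ∀ a, π a = 0 → f a = 0) : A' →ₗ[K] D :=
  ((LinearMap.ker π).liftQ f h).comp (π.quotKerEquivOfSurjective hπ).symm.toLinearMap

theorem descend_apply (π : A →ₗ[K] A') (hπ : Function.Surjective π) (f : A →ₗ[K] D)
    (h : ∀ a, π a = 0 → f a = 0) (a : A) : descend π hπ f h (π a) = f a := by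
  have : (π.quotKerEquivOfSurjective hπ).symm (π a) = (LinearMap.ker π).mkQ a := by
    rw [LinearEquiv.symm_apply_eq]; rfl
  simp only [descend, LinearMap.comp_apply, LinearEquiv.coe_coe, this]
  rfl

end Descent

section Cycles
variable (C : ChainComplex (ModuleCat.{u} K) ℕ)

/-- The cycles in degree `n`; recall that `C.d 0 0 = 0`. -/
def cycles (n : ℕ) : Submodule K (C.X n) := LinearMap.ker (C.d n (n - 1)).hom

/-- The homology class of a cycle. -/
def homologyClass (n : ℕ) : cycles C n →ₗ[K] C.homology n :=
  (C.liftCycles (ModuleCat.ofHom (cycles C n).subtype) (n - 1) (by cases n <;> simp)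
    (by ext x; exact x.2) ≫ C.homologyπ n).hom

theorem homologyClass_surjective (n : ℕ) : Function.Surjective (homologyClass C n) := by
  intro y
  obtain ⟨z, rfl⟩ := (ModuleCat.epi_iff_surjective (C.homologyπ n)).1 inferInstance y
  have hz : (C.d n (n - 1)).hom ((C.iCycles n).hom z) = 0 :=
    congrArg (fun f => f.hom z) (C.iCycles_d n (n - 1))
  refine ⟨⟨(C.iCycles n).hom z, hz⟩, ?_⟩
  refine congrArg (C.homologyπ n).hom ?_
  apply (ModuleCat.mono_iff_injective (C.iCycles n)).1 inferInstance
  exact congrArg (fun f => f.hom (⟨(C.iCycles n).hom z, hz⟩ : cycles C n)) (C.liftCycles_i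
    (ModuleCat.ofHom (cycles C n).subtype) (n - 1) (by cases n <;> simp) (by ext x; exact x.2))

theorem homologyClass_eq_zero_iff (n : ℕ) (z : cycles C n) :
    homologyClass C n z = 0 ↔ ∃ c, (C.d (n + 1) n).hom c = z := by
  have hi : ∀ z : cycles C n, (C.iCycles n).hom ((C.liftCycles
      (ModuleCat.ofHom (cycles C n).subtype) (n - 1) (by cases n <;> simp)
      (by ext x; exact x.2)).hom z) = z := fun z =>
    congrArg (fun f => f.hom z) (C.liftCycles_i
    (ModuleCat.ofHom (cycles C n).subtype) (n - 1) (by cases n <;> simp) (by ext x; exact x.2))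
  have hinj := (ModuleCat.mono_iff_injective (C.iCycles n)).1 inferInstance
  have ht : ∀ c, (C.iCycles n).hom ((C.toCycles (n + 1) n).hom c) = (C.d (n + 1) n).hom c :=
    fun c => congrArg (fun f => f.hom c) (C.toCycles_i (n + 1) n)
  have hex : (ShortComplex.mk (C.toCycles (n + 1) n) (C.homologyπ n)
      (C.toCycles_comp_homologyπ _ _)).Exact :=
    ShortComplex.exact_of_g_is_cokernel _ (C.homologyIsCokernel (n + 1) n (by simp))
  constructor
  · intro h
    obtain ⟨c, hc⟩ := (ShortComplex.moduleCat_exact_iff _).1 hex _ h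
    exact ⟨c, by rw [← ht, ← hi z]; exact congrArg _ hc⟩
  · rintro ⟨c, hc⟩
    have : (C.toCycles (n + 1) n).hom c = (C.liftCycles
      (ModuleCat.ofHom (cycles C n).subtype) (n - 1) (by cases n <;> simp)
      (by ext x; exact x.2)).hom z := hinj (by rw [ht, hi]; exact hc)
    refine (congrArg (C.homologyπ n).hom this.symm).trans ?_
    exact congrArg (fun f => f.hom c) (C.toCycles_comp_homologyπ (n + 1) n)
end Cycles

theorem cross_mem_cycles {p q n : ℕ} (h : p + q = n) {a : (singularChains K X).X p}
    {b : (singularChains K Y).X q} (ha : a ∈ cycles (singularChains K X) p)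
    (hb : b ∈ cycles (singularChains K Y) q) :
    chainCross K p q n a b ∈ cycles (singularChains K (X × Y)) n := by
  rcases n with _ | n
  · rw [cycles, LinearMap.mem_ker, (singularChains K (X × Y)).shape _ _ (by simp)]; rfl
  · change ((singularChains K (X × Y)).d (n + 1) n).hom _ = 0
    rw [d_cross h, LinearMap.mem_ker.1 ha, LinearMap.mem_ker.1 hb]; simp

variable (K X Y) in
/-- The homology class of the cross product of two cycles. -/
def crossClass {p q n : ℕ} (h : p + q = n) : cycles (singularChains K X) p →ₗ[K]
    cycles (singularChains K Y) q →ₗ[K] SingularHomology K (X × Y) n :=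
  LinearMap.mk₂ K (fun a b => homologyClass (singularChains K (X × Y)) n
      ⟨chainCross K p q n a.1 b.1, cross_mem_cycles h a.2 b.2⟩)
    (fun a a' b => by rw [← map_add]; congr 1; ext; simp)
    (fun c a b => by rw [← map_smul]; congr 1; ext; simp)
    (fun a b b' => by rw [← map_add]; congr 1; ext; simp)
    (fun c a b => by rw [← map_smul]; congr 1; ext; simp)

theorem crossClass_eq_zero_left {p q n : ℕ} (h : p + q = n) (a : cycles (singularChains K X) p)
    (b : cycles (singularChains K Y) q) (ha : homologyClass (singularChains K X) p a = 0) :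
    crossClass K X Y h a b = 0 := by
  obtain ⟨c, hc⟩ := (homologyClass_eq_zero_iff _ _ _).1 ha
  refine (homologyClass_eq_zero_iff _ _ _).2 ⟨chainCross K (p + 1) q (n + 1) c b.1, ?_⟩
  rw [d_cross (by omega), LinearMap.mem_ker.1 b.2, map_zero, smul_zero, add_zero]
  exact congrArg (fun a => chainCross K p q n a b.1) hc

theorem crossClass_eq_zero_right {p q n : ℕ} (h : p + q = n) (a : cycles (singularChains K X) p)
    (b : cycles (singularChains K Y) q) (hb : homologyClass (singularChains K Y) q b = 0) :
    crossClass K X Y h a b = 0 := by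
  obtain ⟨c, hc⟩ := (homologyClass_eq_zero_iff _ _ _).1 hb
  refine (homologyClass_eq_zero_iff _ _ _).2 ⟨(-1 : K) ^ p • chainCross K p (q + 1) (n + 1) a.1 c, ?_⟩
  rw [map_smul, d_cross (by omega), LinearMap.mem_ker.1 a.2, map_zero, LinearMap.zero_apply,
    zero_add, smul_smul, ← mul_pow, neg_one_mul, neg_neg, one_pow, one_smul]
  exact congrArg (fun b => chainCross K p q n a.1 b) hc

variable (K X Y) in
/-- The homology cross product `H_p(X) × H_q(Y) → H_n(X × Y)`, `n = p + q`. -/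
def homologyCross {p q n : ℕ} (h : p + q = n) : SingularHomology K X p →ₗ[K]
    SingularHomology K Y q →ₗ[K] SingularHomology K (X × Y) n :=
  descend (homologyClass (singularChains K X) p) (homologyClass_surjective _ p)
    (descend (homologyClass (singularChains K Y) q) (homologyClass_surjective _ q)
      (crossClass K X Y h).flip
      fun b hb => LinearMap.ext fun a => crossClass_eq_zero_right h a b hb).flip
    fun a ha => LinearMap.ext fun y => by
      obtain ⟨b, rfl⟩ := homologyClass_surjective (singularChains K Y) q y
      exact (DFunLike.congr_fun (descend_apply (homologyClass (singularChains K Y) q)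
        (homologyClass_surjective _ q) (crossClass K X Y h).flip
        (fun b hb => LinearMap.ext fun a => crossClass_eq_zero_right h a b hb) b) a).trans
        (crossClass_eq_zero_left h a b ha)

theorem homologyCross_class {p q n : ℕ} (h : p + q = n) (a : cycles (singularChains K X) p)
    (b : cycles (singularChains K Y) q) :
    homologyCross K X Y h (homologyClass _ p a) (homologyClass _ q b) =
      homologyClass (singularChains K (X × Y)) n
        ⟨chainCross K p q n a.1 b.1, cross_mem_cycles h a.2 b.2⟩ := by
  rw [homologyCross, descend_apply, LinearMap.flip_apply, descend_apply]
  rfl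
end Chains

/-! ### Directional graded vector spaces -/

section Directional
variable (K : Type u) [Field K] {ι : Type} [Add ι] [DecidableEq ι]

/-- The degree `n` part `⨁_{i + j = n} V_i ⊗ W_j` of the tensor product of two graded vector
spaces. -/
abbrev GradedTensor (V W : ι → Type u) [∀ i, AddCommGroup (V i)] [∀ i, Module K (V i)]
    [∀ i, AddCommGroup (W i)] [∀ i, Module K (W i)] (n : ι) : Type u :=
  ⨁ ij : {ij : ι × ι // ij.1 + ij.2 = n}, V ij.1.1 ⊗[K] W ij.1.2

/-- A graded vector subspace of a graded vector space. -/
abbrev GradedSubspace (V : ι → Type u) [∀ i, AddCommGroup (V i)] [∀ i, Module K (V i)] :=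
  ∀ n, Submodule K (V n)

variable {V W : ι → Type u} [∀ i, AddCommGroup (V i)] [∀ i, Module K (V i)]
    [∀ i, AddCommGroup (W i)] [∀ i, Module K (W i)]

/-- The homogeneous element `v ⊗ w`, of degree `deg v + deg w`, where `v` and `w` are homogeneous
elements (elements of the disjoint union of the graded pieces). -/
def tmul (v : Σ i, V i) (w : Σ i, W i) : Σ n, GradedTensor K V W n :=
  ⟨v.1 + w.1, DirectSum.lof K {ij : ι × ι // ij.1 + ij.2 = v.1 + w.1}
    (fun ij => V ij.1.1 ⊗[K] W ij.1.2) ⟨(v.1, w.1), rfl⟩ (v.2 ⊗ₜ[K] w.2)⟩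

/-- The graded vector subspace spanned by a set of homogeneous elements. -/
def gradedSpan (s : Set (Σ n, V n)) : GradedSubspace K V :=
  fun n => Submodule.span K {x | (⟨n, x⟩ : Σ n, V n) ∈ s}

/-- The relation `v ⊗ w ∈ R` on a graded vector space `V` defined by a graded vector subspace `R`
of `V ⊗ V`. -/
def definedRel (R : GradedSubspace K (GradedTensor K V V)) (v w : Σ i, V i) : Prop :=
  (tmul K v w).2 ∈ R (tmul K v w).1

/-- A relation on a graded vector space `V` is bilinear if it is defined by a graded vector
subspace of `V ⊗ V`. -/
def IsBilinear (r : (Σ i, V i) → (Σ i, V i) → Prop) : Prop :=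
  ∃ R : GradedSubspace K (GradedTensor K V V), ∀ v w, r v w ↔ definedRel K R v w

/-- The bilinear relation generated by a relation: the intersection of all bilinear relations that
contain it. -/
def generatedRel (r : (Σ i, V i) → (Σ i, V i) → Prop) (v w : Σ i, V i) : Prop :=
  ∀ s : (Σ i, V i) → (Σ i, V i) → Prop, IsBilinear K s → (∀ a b, r a b → s a b) → s v w

theorem isBilinear_generatedRel (r : (Σ i, V i) → (Σ i, V i) → Prop) :
    IsBilinear K (generatedRel K r) := by
  refine ⟨fun n => ⨅ R : {R : GradedSubspace K (GradedTensor K V V) //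
    ∀ a b, r a b → definedRel K R a b}, R.1 n, fun v w => ?_⟩
  simp only [definedRel, Submodule.mem_iInf]
  constructor
  · exact fun h R => h (definedRel K R.1) ⟨R.1, fun _ _ => Iff.rfl⟩ R.2
  · rintro h s ⟨R, hR⟩ hs
    exact (hR v w).2 (h ⟨R, fun a b hab => (hR a b).1 (hs a b hab)⟩)

variable (ι) in
/-- A directional graded vector space: a graded vector space with a bilinear relation on its
homogeneous elements, the pointing relation. -/
structure DirectionalSpace where
  /-- The graded pieces. -/
  carrier : ι → Type u
  [addCommGroup : ∀ i, AddCommGroup (carrier i)]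
  [module : ∀ i, Module K (carrier i)]
  /-- The pointing relation. -/
  PointsTo : (Σ i, carrier i) → (Σ i, carrier i) → Prop
  bilinear : IsBilinear K PointsTo

attribute [instance] DirectionalSpace.addCommGroup DirectionalSpace.module

namespace DirectionalSpace
variable {K}

/-- The tensor product `V ⊗ W`, with the pointing relation defined by the graded vector subspace
`⟨v ⊗ w ⊗ v' ⊗ w' | v ↘ v', w ↘ w'⟩` of `V ⊗ W ⊗ V ⊗ W`. -/
def tensor (V W : DirectionalSpace K ι) : DirectionalSpace K ι where
  carrier := GradedTensor K V.carrier W.carrier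
  PointsTo := definedRel K (gradedSpan K {x | ∃ v v' w w', V.PointsTo v v' ∧ W.PointsTo w w' ∧
    x = tmul K (tmul K v w) (tmul K v' w')})
  bilinear := ⟨_, fun _ _ => Iff.rfl⟩

/-- A morphism of graded vector spaces (of degree zero) is a morphism of directional graded vector
spaces if it is compatible with the pointing relations. -/
def IsMorphism (V W : DirectionalSpace K ι) (f : ∀ n, V.carrier n →ₗ[K] W.carrier n) : Prop :=
  ∀ v v', V.PointsTo v v' → W.PointsTo ⟨v.1, f v.1 v.2⟩ ⟨v'.1, f v'.1 v'.2⟩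

/-- A morphism of graded vector spaces is an isomorphism of directional graded vector spaces if it
is a morphism of directional graded vector spaces with an inverse that is one as well. -/
def IsIsomorphism (V W : DirectionalSpace K ι) (f : ∀ n, V.carrier n →ₗ[K] W.carrier n) : Prop :=
  IsMorphism V W f ∧ ∃ g : ∀ n, W.carrier n →ₗ[K] V.carrier n, IsMorphism W V g ∧
    (∀ n, g n ∘ₗ f n = LinearMap.id) ∧ (∀ n, f n ∘ₗ g n = LinearMap.id)

end DirectionalSpace
end Directional

/-! ### The homology digraph -/

section Digraph
variable (K : Type u) [Field K] (X Y : Type u) [TopologicalSpace X] [TopologicalSpace Y]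

variable {X} in
/-- The map `H_n(E) → H_n(X)` induced by the inclusion of a subspace `E` of `X`. -/
def inclusionMap (E : Set X) (n : ℕ) : SingularHomology K E n →ₗ[K] SingularHomology K X n :=
  (HomologicalComplex.homologyMap
    (((singularChainComplexFunctor (ModuleCat.{u} K)).obj (ModuleCat.of K K)).map
      (TopCat.ofHom (⟨Subtype.val, continuous_subtype_val⟩ : C(E, X)))) n).hom

/-- The relation `α ↗ β` on the homology of a preordered space: there are subspaces `E` and `F`
with `x ≤ y` for all `x ∈ E` and `y ∈ F` such that `α` comes from `E` and `β` comes from `F`. -/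
def HomologyEdge [Preorder X] (α β : Σ n, SingularHomology K X n) : Prop :=
  ∃ E F : Set X, α.2 ∈ LinearMap.range (inclusionMap K E α.1) ∧
    β.2 ∈ LinearMap.range (inclusionMap K F β.1) ∧ ∀ x ∈ E, ∀ y ∈ F, x ≤ y

/-- The homology digraph of a preordered space: its singular homology, with the bilinear relation
generated by the relation `HomologyEdge`. -/
def homologyDigraph [Preorder X] : DirectionalSpace K ℕ where
  carrier n := SingularHomology K X n
  PointsTo := generatedRel K (HomologyEdge K X)
  bilinear := isBilinear_generatedRel K _

/-- The cross product `H_*(X) ⊗ H_*(Y) → H_*(X × Y)`, `α ⊗ β ↦ α × β`. -/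
def crossProduct [Preorder X] [Preorder Y] (n : ℕ) :
    ((homologyDigraph K X).tensor (homologyDigraph K Y)).carrier n →ₗ[K]
      (homologyDigraph K (X × Y)).carrier n :=
  DirectSum.toModule K {pq : ℕ × ℕ // pq.1 + pq.2 = n} (SingularHomology K (X × Y) n)
    fun pq => TensorProduct.lift (homologyCross K X Y pq.2)

end Digraph

end HomologyDigraph

end

noncomputable section

namespace HomologyDigraph

open CategoryTheory AlgebraicTopology
open scoped DirectSum TensorProduct

/-! ### Functoriality of chains and homology -/

section Functoriality

section Cycles
variable {K : Type u} [Field K] {C D : ChainComplex (ModuleCat.{u} K) ℕ}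

/-! The theorem combines the Künneth isomorphism over a field with the fact that the edge relation
is compatible with products and projections of subspaces.

If classes come from `E ⊆ X` and `E' ⊆ Y`, their cross product comes from `E ×ˢ E'`; and `E ≤ F`,
`E' ≤ F'` imply `E ×ˢ E' ≤ F ×ˢ F'`. So cross products of edges are edges (`HomologyEdge.cross`),
and bilinearity does the rest for the forward direction. Conversely, a class that comes from `E ⊆ X
× Y` factors through `A × B`, where `A` and `B` are the projections of `E`. Surjectivity of the
cross product for `A × B`, rather than for `X × Y`, writes it as a sum of cross products of classes
from `A` and classes from `B` (`exists_totalCross_eq_of_mem_range`). If `E ≤ F` componentwise, the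
projections of `E` lie below those of `F`, so the preimage of an edge is a sum of tensors built from
edges of `X` and of `Y`. Pointing relations are defined by spans of tensors, which can be compared
one bidegree at a time (`definedRel_gradedSpan_iff`), so checking generators suffices.

Surjectivity in the Künneth theorem: by acyclic models, the Alexander–Whitney map followed by the
cross product sends each cycle to a homologous one (`exists_natural_homotopy`); and over a field
each cycle of a tensor product of complexes is homologous to a sum of tensor products of cycles
(`exists_tmul_cycles`).

Injectivity is proved by duality, without a second homotopy. Linear forms on `H_p(X)` and `H_q(Y)`
are represented by cocycles `φ`, `ψ` that vanish on degenerate simplices. Composing `φ ⊗ ψ` with the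
Alexander–Whitney map gives a cocycle on `X × Y` whose value on `a × b` is `φ a * ψ b` in bidegree
`(p, q)` and zero in the other bidegrees. Such forms separate the elements of the tensor product. -/

theorem chain_map_d (f : C ⟶ D) (i j : ℕ) (c : C.X i) :
    (D.d i j).hom ((f.f i).hom c) = (f.f j).hom ((C.d i j).hom c) :=
  congrArg (fun g => g.hom c) (f.comm i j)

theorem d_d_apply (i j k : ℕ) (c : C.X i) : (C.d j k).hom ((C.d i j).hom c) = 0 :=
  congrArg (fun g => g.hom c) (C.d_comp_d i j k)

theorem chain_map_mem_cycles (f : C ⟶ D) {n : ℕ} {c : C.X n} (hc : c ∈ cycles C n) :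
    (f.f n).hom c ∈ cycles D n := by
  rw [cycles, LinearMap.mem_ker, chain_map_d, LinearMap.mem_ker.1 hc, map_zero]

theorem d_mem_cycles (n : ℕ) (c : C.X (n + 1)) : (C.d (n + 1) n).hom c ∈ cycles C n :=
  d_d_apply _ _ _ _

theorem homologyMap_homologyClass (f : C ⟶ D) {n : ℕ} (z : cycles C n) :
    (HomologicalComplex.homologyMap f n).hom (homologyClass C n z) =
      homologyClass D n ⟨(f.f n).hom z.1, chain_map_mem_cycles f z.2⟩ := by
  have h1 := congrArg (fun g => g.hom ((C.liftCycles (ModuleCat.ofHom (cycles C n).subtype) (n - 1)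
    (by cases n <;> simp) (by ext x; exact x.2)).hom z))
    (HomologicalComplex.homologyπ_naturality f n)
  refine h1.trans ?_
  refine congrArg (D.homologyπ n).hom ?_
  apply (ModuleCat.mono_iff_injective (D.iCycles n)).1 inferInstance
  have h2 := congrArg (fun g => g.hom ((C.liftCycles (ModuleCat.ofHom (cycles C n).subtype) (n - 1)
    (by cases n <;> simp) (by ext x; exact x.2)).hom z)) (HomologicalComplex.cyclesMap_i f n)
  refine h2.trans ?_
  have h3 := congrArg (fun g => g.hom z) (C.liftCycles_i
    (ModuleCat.ofHom (cycles C n).subtype) (n - 1) (by cases n <;> simp) (by ext x; exact x.2))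
  refine (congrArg (f.f n).hom h3).trans ?_
  exact (congrArg (fun g => g.hom (⟨(f.f n).hom z.1, chain_map_mem_cycles f z.2⟩ : cycles D n))
    (D.liftCycles_i (ModuleCat.ofHom (cycles D n).subtype) (n - 1) (by cases n <;> simp)
      (by ext x; exact x.2))).symm

end Cycles

variable (K : Type u) [Field K] {X Y Z : Type u} [TopologicalSpace X] [TopologicalSpace Y]
  [TopologicalSpace Z]

/-- The chain map induced by a continuous map. -/
def chainMap (f : C(X, Y)) : singularChains K X ⟶ singularChains K Y :=
  ((singularChainComplexFunctor (ModuleCat.{u} K)).obj (ModuleCat.of K K)).map (TopCat.ofHom f)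

/-- The linear map on chains in degree `n` induced by a continuous map. -/
def push (f : C(X, Y)) (n : ℕ) : (singularChains K X).X n →ₗ[K] (singularChains K Y).X n :=
  ((chainMap K f).f n).hom

/-- The linear map on homology induced by a continuous map. -/
def pushHomology (f : C(X, Y)) (n : ℕ) : SingularHomology K X n →ₗ[K] SingularHomology K Y n :=
  (HomologicalComplex.homologyMap (chainMap K f) n).hom

variable {K}

theorem push_simplexChain (f : C(X, Y)) {n : ℕ} (σ : C(stdSimplex ℝ (Fin (n + 1)), X)) :
    push K f n (simplexChain K σ) = simplexChain K (f.comp σ) := by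
  have := SSet.ι_chainComplexMap_f _ _ (f := TopCat.toSSet.map (TopCat.ofHom f)) (R := ModuleCat.of K K)
    (((TopCat.of X).toSSetObjEquiv (.op (.mk n))).symm σ)
  exact congrArg (fun g => g.hom (1 : K)) this

theorem d_push (f : C(X, Y)) (i j : ℕ) (c : (singularChains K X).X i) :
    ((singularChains K Y).d i j).hom (push K f i c) =
      push K f j (((singularChains K X).d i j).hom c) := chain_map_d _ _ _ _

theorem push_mem_cycles (f : C(X, Y)) {n : ℕ} {c : (singularChains K X).X n}
    (hc : c ∈ cycles (singularChains K X) n) : push K f n c ∈ cycles (singularChains K Y) n :=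
  chain_map_mem_cycles _ hc

theorem pushHomology_homologyClass (f : C(X, Y)) {n : ℕ} (z : cycles (singularChains K X) n) :
    pushHomology K f n (homologyClass _ n z) =
      homologyClass (singularChains K Y) n ⟨push K f n z.1, push_mem_cycles f z.2⟩ :=
  homologyMap_homologyClass _ _

theorem pushHomology_comp (g : C(Y, Z)) (f : C(X, Y)) (n : ℕ) :
    pushHomology K (g.comp f) n = pushHomology K g n ∘ₗ pushHomology K f n := by
  have : chainMap K (g.comp f) = chainMap K f ≫ chainMap K g :=
    ((singularChainComplexFunctor (ModuleCat.{u} K)).obj (ModuleCat.of K K)).map_comp _ _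
  rw [pushHomology, this, HomologicalComplex.homologyMap_comp]
  rfl

theorem inclusionMap_eq (E : Set X) (n : ℕ) :
    inclusionMap K E n = pushHomology K ⟨Subtype.val, continuous_subtype_val⟩ n := rfl

theorem pushHomology_eq_of_homotopic {f g : C(X, Y)} (h : f.Homotopic g) (n : ℕ) :
    pushHomology K f n = pushHomology K g n := by
  obtain ⟨H⟩ := h
  exact congrArg ModuleCat.Hom.hom
    (TopCat.Homotopy.congr_homologyMap_singularChainComplexFunctor (f := TopCat.ofHom f)
      (g := TopCat.ofHom g) H (ModuleCat.of K K) n)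

/-- Up to homotopy the identity factors through a point, which has no homology in nonzero degrees.
This is the acyclicity of the models. -/
theorem homology_eq_zero_of_contractible [ContractibleSpace X] {n : ℕ} (hn : n ≠ 0)
    (x : SingularHomology K X n) : x = 0 := by
  obtain ⟨e⟩ := ContractibleSpace.hequiv_unit' (X := X)
  let f : C(X, PUnit.{u + 1}) := ⟨fun _ => PUnit.unit, continuous_const⟩
  let g : C(PUnit.{u + 1}, X) := ⟨fun _ => e.invFun (), continuous_const⟩
  have hgf : (g.comp f).Homotopic (ContinuousMap.id X) := e.left_inv
  have hz : Limits.IsZero (((singularHomologyFunctor (ModuleCat.{u} K) n).obj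
      (ModuleCat.of K K)).obj (TopCat.of PUnit.{u + 1})) :=
    isZero_singularHomologyFunctor_of_totallyDisconnectedSpace _ n _ _ hn
  have hs : Subsingleton (SingularHomology K PUnit.{u + 1} n) :=
    ModuleCat.subsingleton_of_isZero hz
  have hid : pushHomology K (ContinuousMap.id X) n x = x := by
    have : chainMap K (ContinuousMap.id X) = 𝟙 _ :=
      ((singularChainComplexFunctor (ModuleCat.{u} K)).obj (ModuleCat.of K K)).map_id _
    rw [pushHomology, this, HomologicalComplex.homologyMap_id]
    rfl
  rw [← hid, ← pushHomology_eq_of_homotopic hgf, pushHomology_comp, LinearMap.comp_apply,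
    Subsingleton.elim (pushHomology K f n x) 0, map_zero]

theorem exists_d_eq_of_contractible [ContractibleSpace X] {n : ℕ} (hn : n ≠ 0)
    {z : (singularChains K X).X n} (hz : z ∈ cycles (singularChains K X) n) :
    ∃ c, ((singularChains K X).d (n + 1) n).hom c = z :=
  (homologyClass_eq_zero_iff _ n ⟨z, hz⟩).1 (homology_eq_zero_of_contractible hn _)

end Functoriality

/-! ### The Alexander–Whitney map -/

section AlexanderWhitney
variable {K : Type u} [Field K] {X Y X' Y' : Type u} [TopologicalSpace X] [TopologicalSpace Y]
  [TopologicalSpace X'] [TopologicalSpace Y']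

theorem push_chainCross (f : C(X, X')) (g : C(Y, Y')) (p q n : ℕ) (a : (singularChains K X).X p)
    (b : (singularChains K Y).X q) :
    push K (f.prodMap g) n (chainCross K p q n a b) =
      chainCross K p q n (push K f p a) (push K g q b) := by
  have key : (chainCross K p q n).compr₂ (push K (f.prodMap g) n) =
      (chainCross K p q n).compl₁₂ (push K f p) (push K g q) := by
    refine chain_hom_ext fun σ => chain_hom_ext fun τ => ?_
    simp only [LinearMap.compr₂_apply, LinearMap.compl₁₂_apply, push_simplexChain, cross_simplex,
      shuffleProduct, map_sum, map_smul]
    rfl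
  exact congrArg (fun h => h a b) key

variable (K X Y) in
/-- The component in `S_p(X) ⊗ S_q(Y)` of the Alexander–Whitney map: a singular `n`-simplex of
`X × Y` is sent to the tensor product of the front `p`-face of its first component and the back
`q`-face of its second component. -/
def alexanderWhitney (p q n : ℕ) : (singularChains K (X × Y)).X n →ₗ[K]
    (singularChains K X).X p ⊗[K] (singularChains K Y).X q :=
  chainLift fun σ =>
    simplexChain K ((ContinuousMap.fst.comp σ).comp (vertexMap (fun k => k) p n)) ⊗ₜ[K]
      simplexChain K ((ContinuousMap.snd.comp σ).comp (vertexMap (fun k => k + p) q n))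

theorem alexanderWhitney_simplexChain (p q n : ℕ) (σ : C(stdSimplex ℝ (Fin (n + 1)), X × Y)) :
    alexanderWhitney K X Y p q n (simplexChain K σ) =
      simplexChain K ((ContinuousMap.fst.comp σ).comp (vertexMap (fun k => k) p n)) ⊗ₜ[K]
        simplexChain K ((ContinuousMap.snd.comp σ).comp (vertexMap (fun k => k + p) q n)) :=
  chainLift_simplexChain _ _

theorem alexanderWhitney_push (f : C(X, X')) (g : C(Y, Y')) (p q n : ℕ)
    (c : (singularChains K (X × Y)).X n) :
    alexanderWhitney K X' Y' p q n (push K (f.prodMap g) n c) =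
      TensorProduct.map (push K f p) (push K g q) (alexanderWhitney K X Y p q n c) := by
  have key : alexanderWhitney K X' Y' p q n ∘ₗ push K (f.prodMap g) n =
      TensorProduct.map (push K f p) (push K g q) ∘ₗ alexanderWhitney K X Y p q n := by
    refine chain_hom_ext fun σ => ?_
    simp only [LinearMap.comp_apply, push_simplexChain, alexanderWhitney_simplexChain,
      TensorProduct.map_tmul]
    rfl
  exact congrArg (fun h => h c) key

/-- The Alexander–Whitney map is a chain map. -/
theorem alexanderWhitney_d {p q n : ℕ} (h : p + q = n) (c : (singularChains K (X × Y)).X (n + 1)) :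
    alexanderWhitney K X Y p q n (((singularChains K (X × Y)).d (n + 1) n).hom c) =
      ((singularChains K X).d (p + 1) p).hom.rTensor _ (alexanderWhitney K X Y (p + 1) q (n + 1) c) +
      (-1 : K) ^ p • ((singularChains K Y).d (q + 1) q).hom.lTensor _
        (alexanderWhitney K X Y p (q + 1) (n + 1) c) := by
  have key : alexanderWhitney K X Y p q n ∘ₗ ((singularChains K (X × Y)).d (n + 1) n).hom =
      ((singularChains K X).d (p + 1) p).hom.rTensor _ ∘ₗ alexanderWhitney K X Y (p + 1) q (n + 1) +
      (-1 : K) ^ p • (((singularChains K Y).d (q + 1) q).hom.lTensor _ ∘ₗ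
        alexanderWhitney K X Y p (q + 1) (n + 1)) := by
    refine chain_hom_ext fun σ => ?_
    -- `A i ⊗ B i` is the image of the `i`-th face of `σ` (`h0`). The front part does not see the
    -- omission of a vertex beyond `p` (`hA`), and the back part is the same for every omitted
    -- vertex up to `p` (`hB`).
    let A : ℕ → (singularChains K X).X p := fun i =>
      simplexChain K ((ContinuousMap.fst.comp σ).comp (vertexMap (cf i) p (n + 1)))
    let B : ℕ → (singularChains K Y).X q := fun i =>
      simplexChain K ((ContinuousMap.snd.comp σ).comp (vertexMap (fun k => cf i (k + p)) q (n + 1)))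
    have hA : ∀ i, p < i → A i = A (p + 1) := fun i hi => by
      simp only [A]
      rw [vertexMap_congr (cf i) (cf (p + 1)) p (n + 1) fun k hk => by
        rw [cf, cf, if_pos (by omega), if_pos (by omega)]]
    have hB : ∀ i ≤ p, B i = B p := fun i hi => by
      simp only [B]
      rw [vertexMap_congr _ (fun k => cf p (k + p)) q (n + 1) fun k hk => by
        rw [cf, cf, if_neg (by omega), if_neg (by omega)]]
    have h0 : ∀ i : Fin (n + 2), alexanderWhitney K X Y p q n
        (simplexChain K (σ.comp (faceMap n i))) = A i ⊗ₜ[K] B i := fun i => by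
      rw [alexanderWhitney_simplexChain]
      simp only [A, B]
      rw [vertexMap_cf (fun k => k) (cf i) p n i (fun k hk => by omega) (fun k _ => rfl),
        vertexMap_cf (fun k => k + p) (fun k => cf i (k + p)) q n i (fun k hk => by omega)
          (fun k _ => rfl)]
      rfl
    -- The faces of the front `(p + 1)`-face are `A 0, …, A (p + 1)`; in `h2` those of the back `(q
    -- + 1)`-face are `B p, …, B (p + q + 1)`.
    have h1 : ((singularChains K X).d (p + 1) p).hom (simplexChain K
        ((ContinuousMap.fst.comp σ).comp (vertexMap (fun k => k) (p + 1) (n + 1)))) =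
        ∑ i ∈ Finset.range (p + 2), (-1 : K) ^ i • A i := by
      rw [d_simplexChain, Finset.sum_range]
      refine Finset.sum_congr rfl fun i _ => ?_
      rw [ContinuousMap.comp_assoc, vertexMap_comp_faceMap _ (cf i) _ _ i fun k => ?_]
      unfold cf
      split_ifs with hk
      · rw [Fin.succAbove_of_castSucc_lt _ _ (by simpa [Fin.lt_def] using hk)]; rfl
      · rw [Fin.succAbove_of_le_castSucc _ _ (by simpa [Fin.le_def] using hk)]; rfl
    have h2 : ((singularChains K Y).d (q + 1) q).hom (simplexChain K
        ((ContinuousMap.snd.comp σ).comp (vertexMap (fun k => k + p) (q + 1) (n + 1)))) =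
        ∑ i ∈ Finset.range (q + 2), (-1 : K) ^ i • B (p + i) := by
      rw [d_simplexChain, Finset.sum_range]
      refine Finset.sum_congr rfl fun i _ => ?_
      rw [ContinuousMap.comp_assoc,
        vertexMap_comp_faceMap _ (fun k => cf (p + i) (k + p)) _ _ i fun k => ?_]
      simp only [cf]
      split_ifs with hk
      · rw [Fin.succAbove_of_castSucc_lt _ _ (by rw [Fin.lt_def, Fin.val_castSucc]; omega)]; rfl
      · rw [Fin.succAbove_of_le_castSucc _ _ (by rw [Fin.le_def, Fin.val_castSucc]; omega),
          Fin.val_succ]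
        omega
    have h3 : simplexChain K ((ContinuousMap.snd.comp σ).comp
        (vertexMap (fun k => k + (p + 1)) q (n + 1))) = B p := by
      simp only [B]
      rw [vertexMap_congr _ (fun k => cf p (k + p)) q (n + 1) fun k hk => by
        rw [cf, if_neg (by omega)]; omega]
    have h4 : simplexChain K ((ContinuousMap.fst.comp σ).comp
        (vertexMap (fun k => k) p (n + 1))) = A (p + 1) := by
      simp only [A]
      rw [vertexMap_congr _ (cf (p + 1)) p (n + 1) fun k hk => by rw [cf, if_pos (by omega)]]
    simp only [LinearMap.comp_apply, LinearMap.add_apply, LinearMap.smul_apply,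
      alexanderWhitney_simplexChain, LinearMap.rTensor_tmul, LinearMap.lTensor_tmul, h1, h2, h3, h4]
    rw [d_simplexChain, map_sum]
    simp only [map_smul, h0]
    rw [← Finset.sum_range fun i => (-1 : K) ^ i • A i ⊗ₜ[K] B i,
      show n + 2 = (p + 1) + (q + 1) by omega, Finset.sum_range_add, Finset.sum_range_succ _ (p + 1),
      Finset.sum_range_succ' _ (q + 1), TensorProduct.add_tmul, TensorProduct.tmul_add, smul_add,
      TensorProduct.sum_tmul, TensorProduct.tmul_sum, Finset.smul_sum]
    have e1 : ∀ i ∈ Finset.range (p + 1), ((-1 : K) ^ i • A i) ⊗ₜ[K] B p =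
        (-1 : K) ^ i • A i ⊗ₜ[K] B i := fun i hi => by
      rw [hB i (by simpa [Nat.lt_succ_iff] using hi), TensorProduct.smul_tmul']
    have e2 : ∀ i ∈ Finset.range (q + 1), (-1 : K) ^ p • A (p + 1) ⊗ₜ[K]
        ((-1 : K) ^ (i + 1) • B (p + (i + 1))) =
        (-1 : K) ^ (p + 1 + i) • A (p + 1 + i) ⊗ₜ[K] B (p + 1 + i) := fun i _ => by
      rw [hA (p + 1 + i) (by omega), TensorProduct.tmul_smul, smul_smul, ← pow_add,
        show p + (i + 1) = p + 1 + i by omega]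
    rw [Finset.sum_congr rfl e1, Finset.sum_congr rfl e2]
    -- The right side has two terms more than the left: omitting the last vertex of the front face
    -- and the first vertex of the back face. Both are `A (p + 1) ⊗ B p`, with opposite signs.
    have e3 : ((-1 : K) ^ (p + 1) • A (p + 1)) ⊗ₜ[K] B p +
        (-1 : K) ^ p • A (p + 1) ⊗ₜ[K] ((-1 : K) ^ 0 • B (p + 0)) = 0 := by
      rw [pow_zero, one_smul, add_zero, ← TensorProduct.smul_tmul', ← add_smul, pow_succ]
      simp
    rw [add_add_add_comm, e3, add_zero]
  exact congrArg (fun h => h c) key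

/-! ### The Alexander–Whitney map followed by the cross product -/

/-- The cross product of chains as a linear map on the tensor product. -/
def chainCrossLift (p q n : ℕ) : (singularChains K X).X p ⊗[K] (singularChains K Y).X q →ₗ[K]
    (singularChains K (X × Y)).X n := TensorProduct.lift (chainCross K p q n)

theorem chainCrossLift_tmul (p q n : ℕ) (a : (singularChains K X).X p)
    (b : (singularChains K Y).X q) :
    chainCrossLift p q n (a ⊗ₜ[K] b) = chainCross K p q n a b := rfl

theorem d_chainCrossLift {p q n : ℕ} (h : p + q = n + 1)
    (t : (singularChains K X).X p ⊗[K] (singularChains K Y).X q) :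
    ((singularChains K (X × Y)).d (n + 1) n).hom (chainCrossLift p q (n + 1) t) =
      chainCrossLift (p - 1) q n (((singularChains K X).d p (p - 1)).hom.rTensor _ t) +
      (-1 : K) ^ p • chainCrossLift p (q - 1) n
        (((singularChains K Y).d q (q - 1)).hom.lTensor _ t) := by
  induction t with
  | zero => simp
  | add x y hx hy => simp only [map_add, hx, hy, smul_add]; abel
  | tmul a b => exact d_cross h a b

variable (K X Y) in
/-- The composition of the Alexander–Whitney map with the cross product. -/
def crossAW (n : ℕ) : (singularChains K (X × Y)).X n →ₗ[K] (singularChains K (X × Y)).X n :=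
  ∑ pq ∈ Finset.HasAntidiagonal.antidiagonal n, chainCrossLift pq.1 pq.2 n ∘ₗ alexanderWhitney K X Y pq.1 pq.2 n

theorem crossAW_apply (n : ℕ) (c : (singularChains K (X × Y)).X n) : crossAW K X Y n c =
    ∑ pq ∈ Finset.HasAntidiagonal.antidiagonal n, chainCrossLift pq.1 pq.2 n
      (alexanderWhitney K X Y pq.1 pq.2 n c) := by
  simp [crossAW, LinearMap.sum_apply]

/-- Summing the boundaries of the cross products of a family of elements of `S_p(X) ⊗ S_q(Y)`. -/
theorem sum_d_chainCrossLift (n : ℕ)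
    (t : ∀ p q : ℕ, (singularChains K X).X p ⊗[K] (singularChains K Y).X q) :
    ((singularChains K (X × Y)).d (n + 1) n).hom
      (∑ pq ∈ Finset.HasAntidiagonal.antidiagonal (n + 1), chainCrossLift pq.1 pq.2 (n + 1) (t pq.1 pq.2)) =
    ∑ pq ∈ Finset.HasAntidiagonal.antidiagonal n, chainCrossLift pq.1 pq.2 n
      (((singularChains K X).d (pq.1 + 1) pq.1).hom.rTensor _ (t (pq.1 + 1) pq.2) +
      (-1 : K) ^ pq.1 • ((singularChains K Y).d (pq.2 + 1) pq.2).hom.lTensor _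
        (t pq.1 (pq.2 + 1))) := by
  rw [map_sum, Finset.sum_congr rfl fun pq hpq =>
    d_chainCrossLift (Finset.HasAntidiagonal.mem_antidiagonal.1 hpq) (t pq.1 pq.2), Finset.sum_add_distrib,
    Finset.Nat.sum_antidiagonal_succ, Finset.Nat.sum_antidiagonal_succ']
  simp only [map_add, map_smul, Finset.sum_add_distrib]
  -- Shifting the indices leaves one extra term for each differential, at `p = 0` and at `q = 0`.
  -- Both contain `d 0 (0 - 1) = d 0 0 = 0`.
  have h1 : ((singularChains K X).d 0 (0 - 1)).hom = 0 := by
    rw [(singularChains K X).shape _ _ (by simp)]; rfl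
  have h2 : ((singularChains K Y).d 0 (0 - 1)).hom = 0 := by
    rw [(singularChains K Y).shape _ _ (by simp)]; rfl
  rw [h1, h2, LinearMap.rTensor_zero, LinearMap.lTensor_zero]
  simp

theorem d_crossAW (n : ℕ) (c : (singularChains K (X × Y)).X (n + 1)) :
    ((singularChains K (X × Y)).d (n + 1) n).hom (crossAW K X Y (n + 1) c) =
      crossAW K X Y n (((singularChains K (X × Y)).d (n + 1) n).hom c) := by
  rw [crossAW_apply, crossAW_apply,
    sum_d_chainCrossLift n fun p q => alexanderWhitney K X Y p q (n + 1) c]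
  exact Finset.sum_congr rfl fun pq hpq => by rw [alexanderWhitney_d (Finset.HasAntidiagonal.mem_antidiagonal.1 hpq)]

theorem push_chainCrossLift (f : C(X, X')) (g : C(Y, Y')) (p q n : ℕ)
    (t : (singularChains K X).X p ⊗[K] (singularChains K Y).X q) :
    push K (f.prodMap g) n (chainCrossLift p q n t) =
      chainCrossLift p q n (TensorProduct.map (push K f p) (push K g q) t) := by
  induction t with
  | zero => simp
  | add x y hx hy => simp only [map_add, hx, hy]
  | tmul a b => exact push_chainCross f g p q n a b

theorem crossAW_push (f : C(X, X')) (g : C(Y, Y')) (n : ℕ) (c : (singularChains K (X × Y)).X n) :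
    crossAW K X' Y' n (push K (f.prodMap g) n c) = push K (f.prodMap g) n (crossAW K X Y n c) := by
  rw [crossAW_apply, crossAW_apply, map_sum]
  exact Finset.sum_congr rfl fun pq _ => by rw [push_chainCrossLift, alexanderWhitney_push]

/-- The `0`-simplex has only one self-map and the only `(0, 0)`-shuffle is empty. This starts the
acyclic models induction. -/
theorem crossAW_zero (c : (singularChains K (X × Y)).X 0) : crossAW K X Y 0 c = c := by
  have key : crossAW K X Y 0 = LinearMap.id := by
    refine chain_hom_ext fun σ => ?_
    have hv : ∀ f : ℕ → ℕ, vertexMap f 0 0 = ContinuousMap.id _ := fun f => by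
      ext x : 1
      exact Subsingleton.elim (α := stdSimplex ℝ (Fin 1)) _ _
    rw [crossAW_apply, Finset.Nat.antidiagonal_zero, Finset.sum_singleton,
      alexanderWhitney_simplexChain]
    rw [chainCrossLift_tmul, cross_simplex, shuffleProduct]
    simp [hv]
    rfl
  exact congrArg (fun h => h c) key

end AlexanderWhitney

/-! ### Every homology class of a product is a sum of cross products -/

section Surjectivity
variable (K : Type u) [Field K] (X Y : Type u) [TopologicalSpace X] [TopologicalSpace Y]

/-! ### Acyclic models -/

/-- The standard simplex, in the universe `u`. -/
abbrev USimplex (n : ℕ) : Type u := ULift.{u} (stdSimplex ℝ (Fin (n + 1)))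

instance (n : ℕ) : ContractibleSpace (USimplex.{u} n) := by
  have : ContractibleSpace (stdSimplex ℝ (Fin (n + 1))) :=
    (convex_stdSimplex ℝ (Fin (n + 1))).contractibleSpace ⟨_, single_mem_stdSimplex ℝ 0⟩
  exact Homeomorph.ulift.contractibleSpace

/-- The diagonal singular simplex of the square of the standard simplex. -/
def diagSimplex (n : ℕ) : C(stdSimplex ℝ (Fin (n + 1)), USimplex.{u} n × USimplex.{u} n) :=
  (⟨ULift.up, continuous_uliftUp⟩ : C(_, USimplex.{u} n)).prodMk ⟨ULift.up, continuous_uliftUp⟩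

variable {X Y}

/-- The map of products whose composition with the diagonal simplex is a given simplex. -/
def simplexProdMap {n : ℕ} (σ : C(stdSimplex ℝ (Fin (n + 1)), X × Y)) :
    C(USimplex.{u} n × USimplex.{u} n, X × Y) :=
  ((ContinuousMap.fst.comp σ).comp ⟨ULift.down, continuous_uliftDown⟩).prodMap
    ((ContinuousMap.snd.comp σ).comp ⟨ULift.down, continuous_uliftDown⟩)

/-- Every simplex of a product is the image of the diagonal simplex under a product map, so a
natural map is determined by its value there. -/
theorem simplexProdMap_comp_diagSimplex {n : ℕ} (σ : C(stdSimplex ℝ (Fin (n + 1)), X × Y)) :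
    (simplexProdMap σ).comp (diagSimplex n) = σ := rfl

variable {K} (X Y) in
/-- The natural linear map on chains of products with a given value on the diagonal simplex. -/
def naturalExtension {n m : ℕ} (e : (singularChains K (USimplex.{u} n × USimplex.{u} n)).X m) :
    (singularChains K (X × Y)).X n →ₗ[K] (singularChains K (X × Y)).X m :=
  chainLift fun σ => push K (simplexProdMap σ) m e

variable {K}

theorem naturalExtension_simplexChain {n m : ℕ}
    (e : (singularChains K (USimplex.{u} n × USimplex.{u} n)).X m)
    (σ : C(stdSimplex ℝ (Fin (n + 1)), X × Y)) :
    naturalExtension X Y e (simplexChain K σ) = push K (simplexProdMap σ) m e :=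
  chainLift_simplexChain _ _

theorem push_comp {X Y Z : Type u} [TopologicalSpace X] [TopologicalSpace Y] [TopologicalSpace Z]
    (g : C(Y, Z)) (f : C(X, Y)) (n : ℕ) (c : (singularChains K X).X n) :
    push K (g.comp f) n c = push K g n (push K f n c) := by
  have key : push K (g.comp f) n = push K g n ∘ₗ push K f n :=
    chain_hom_ext fun σ => by
      simp only [LinearMap.comp_apply, push_simplexChain, ContinuousMap.comp_assoc]
  exact congrArg (fun h => h c) key

theorem naturalExtension_push {X' Y' : Type u} [TopologicalSpace X'] [TopologicalSpace Y']
    {n m : ℕ} (e : (singularChains K (USimplex.{u} n × USimplex.{u} n)).X m)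
    (f : C(X, X')) (g : C(Y, Y')) (c : (singularChains K (X × Y)).X n) :
    naturalExtension X' Y' e (push K (f.prodMap g) n c) =
      push K (f.prodMap g) m (naturalExtension X Y e c) := by
  have key : naturalExtension X' Y' e ∘ₗ push K (f.prodMap g) n =
      push K (f.prodMap g) m ∘ₗ naturalExtension X Y e :=
    chain_hom_ext fun σ => by
      simp only [LinearMap.comp_apply, push_simplexChain, naturalExtension_simplexChain]
      rw [← push_comp]
      rfl
  exact congrArg (fun h => h c) key

variable (K) in
/-- The composition of the Alexander–Whitney map and the cross product is naturally homologous to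
the identity on cycles. -/
theorem exists_natural_homotopy (n : ℕ) :
    ∃ e : (singularChains K (USimplex.{u} n × USimplex.{u} n)).X (n + 1),
      ∀ (X Y : Type u) [TopologicalSpace X] [TopologicalSpace Y],
      ∀ c ∈ cycles (singularChains K (X × Y)) n,
        ((singularChains K (X × Y)).d (n + 1) n).hom (naturalExtension X Y e c) =
          crossAW K X Y n c - c := by
  induction n with
  | zero => exact ⟨0, fun X Y _ _ c _ => by
      rw [crossAW_zero, sub_self]
      have : naturalExtension X Y (0 : (singularChains K (USimplex.{u} 0 × USimplex.{u} 0)).X 1) =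
          0 := chain_hom_ext fun σ => by rw [naturalExtension_simplexChain, map_zero]; rfl
      rw [this, LinearMap.zero_apply, map_zero]⟩
  | succ n ih =>
    obtain ⟨e, he⟩ := ih
    let δ := simplexChain K (diagSimplex.{u} (n + 1))
    let U := USimplex.{u} (n + 1)
    -- The homotopy equation on the universal simplex asks for a chain with boundary `z`. For `z` to
    -- be a cycle, the inductive hypothesis is needed only for `d δ`, which is itself a cycle; this
    -- is why a statement about cycles is strong enough for the induction.
    let z := crossAW K U U (n + 1) δ - δ -
      naturalExtension U U e (((singularChains K (U × U)).d (n + 1) n).hom δ)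
    have hz : z ∈ cycles (singularChains K (U × U)) (n + 1) := by
      change ((singularChains K (U × U)).d (n + 1) n).hom z = 0
      simp only [z]
      rw [map_sub, map_sub, d_crossAW, he U U _ (d_mem_cycles n δ), sub_self]
    obtain ⟨e', he'⟩ := exists_d_eq_of_contractible (Nat.succ_ne_zero n) hz
    -- By naturality the equation on `δ` gives the homotopy equation on all chains. On cycles its
    -- last term disappears.
    have key : ∀ (X Y : Type u) [TopologicalSpace X] [TopologicalSpace Y],
        ((singularChains K (X × Y)).d (n + 2) (n + 1)).hom ∘ₗ naturalExtension X Y e' =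
        crossAW K X Y (n + 1) - LinearMap.id -
          naturalExtension X Y e ∘ₗ ((singularChains K (X × Y)).d (n + 1) n).hom := by
      intro X Y _ _
      refine chain_hom_ext fun σ => ?_
      simp only [LinearMap.comp_apply, LinearMap.sub_apply, LinearMap.id_apply]
      rw [naturalExtension_simplexChain, d_push, he']
      have hσ : simplexChain K σ = push K (simplexProdMap σ) (n + 1) δ := by
        rw [push_simplexChain, simplexProdMap_comp_diagSimplex]
      rw [hσ, d_push]
      simp only [z, map_sub]
      rw [simplexProdMap, crossAW_push, naturalExtension_push]
    refine ⟨e', fun X Y _ _ c hc => ?_⟩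
    have h1 := congrArg (fun h => h c) (key X Y)
    simp only [LinearMap.comp_apply, LinearMap.sub_apply, LinearMap.id_apply] at h1
    rw [h1, show ((singularChains K (X × Y)).d (n + 1) n).hom c = 0 from hc, map_zero, sub_zero]

/-! ### Cycles in a tensor product of complexes of vector spaces -/

/-- A linear map between vector spaces has a generalized inverse. -/
theorem exists_generalized_inverse {V W : Type u} [AddCommGroup V] [Module K V] [AddCommGroup W]
    [Module K W] (d : V →ₗ[K] W) : ∃ s : W →ₗ[K] V, d ∘ₗ s ∘ₗ d = d := by
  -- A section of `d` over its range, extended to the whole of `W`.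
  obtain ⟨r, hr⟩ := d.rangeRestrict.exists_rightInverse_of_surjective d.range_rangeRestrict
  obtain ⟨s, hs⟩ := r.exists_extend
  refine ⟨s, LinearMap.ext fun v => ?_⟩
  have h1 : s (d v) = r (d.rangeRestrict v) := congrArg (fun f => f (d.rangeRestrict v)) hs
  have h2 := congrArg (fun f => (f (d.rangeRestrict v)).1) hr
  simp only [LinearMap.comp_apply, h1]
  exact h2

/-- Generalized inverses `s` of the differentials of a complex of vector spaces; `e` is the
composition of a differential with its generalized inverse. -/
theorem exists_splitting (C : ChainComplex (ModuleCat.{u} K) ℕ) :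
    ∃ (s : ∀ p, C.X p →ₗ[K] C.X (p + 1)) (e : ∀ p, C.X p →ₗ[K] C.X p), e 0 = 0 ∧
      (∀ p, e (p + 1) = s p ∘ₗ (C.d (p + 1) p).hom) ∧
      ∀ p x, (C.d p (p - 1)).hom (e p x) = (C.d p (p - 1)).hom x := by
  choose s hs using fun p => exists_generalized_inverse (C.d (p + 1) p).hom
  refine ⟨s, fun p => match p with
    | 0 => 0
    | p + 1 => s p ∘ₗ (C.d (p + 1) p).hom, rfl, fun _ => rfl, ?_⟩
  rintro (_ | p) x
  · rw [C.shape 0 _ (by simp)]; rfl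
  · exact congrArg (fun f => f x) (hs p)

/-- A cycle of the tensor product of two complexes of vector spaces, given by its components, is
homologous to a sum of tensor products of cycles. -/
theorem exists_tmul_cycles {C D : ChainComplex (ModuleCat.{u} K) ℕ} (n : ℕ)
    (t : ∀ p q : ℕ, C.X p ⊗[K] D.X q)
    (ht : ∀ p q, p + q + 1 = n → (C.d (p + 1) p).hom.rTensor _ (t (p + 1) q) +
      (-1 : K) ^ p • (D.d (q + 1) q).hom.lTensor _ (t p (q + 1)) = 0) :
    ∃ (u : ∀ p q : ℕ, cycles C p ⊗[K] cycles D q) (t' : ∀ p q : ℕ, C.X p ⊗[K] D.X q),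
      ∀ p q, p + q = n → (C.d (p + 1) p).hom.rTensor _ (t' (p + 1) q) +
        (-1 : K) ^ p • (D.d (q + 1) q).hom.lTensor _ (t' p (q + 1)) =
        t p q - TensorProduct.map (cycles _ p).subtype (cycles _ q).subtype (u p q) := by
  obtain ⟨s, e, he0, hes, hde⟩ := exists_splitting C
  obtain ⟨r, f, hf0, hfr, hdf⟩ := exists_splitting D
  -- `P = 1 - d s - s d` takes values in cycles and kills boundaries: `d P = 0` and `P d = 0`. On
  -- the other factor `N = 1 - r d` takes values in cycles, which is all that is needed there.
  let P : ∀ p, C.X p →ₗ[K] C.X p := fun p => LinearMap.id - (C.d (p + 1) p).hom ∘ₗ s p - e p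
  let N : ∀ q, D.X q →ₗ[K] D.X q := fun q => LinearMap.id - f q
  have hP : ∀ p x, P p x ∈ cycles C p := fun p x => by
    change (C.d p (p - 1)).hom (x - (C.d (p + 1) p).hom (s p x) - e p x) = 0
    rw [map_sub, map_sub, d_d_apply, hde, sub_zero, sub_self]
  have hN : ∀ q x, N q x ∈ cycles D q := fun q x => by
    change (D.d q (q - 1)).hom (x - f q x) = 0
    rw [map_sub, hdf, sub_self]
  have hPd : ∀ p, P p ∘ₗ (C.d (p + 1) p).hom = 0 := fun p => LinearMap.ext fun x => by
    have h1 : (C.d (p + 1) p).hom (s p ((C.d (p + 1) p).hom x)) = (C.d (p + 1) p).hom x := by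
      have := hde (p + 1) x
      rwa [hes] at this
    have h2 : e p ((C.d (p + 1) p).hom x) = 0 := by
      rcases p with _ | p
      · rw [he0]; rfl
      · rw [hes, LinearMap.comp_apply, d_d_apply, map_zero]
    change (C.d (p + 1) p).hom x - (C.d (p + 1) p).hom (s p ((C.d (p + 1) p).hom x)) -
      e p ((C.d (p + 1) p).hom x) = 0
    rw [h1, h2, sub_zero, sub_self]
  -- The homotopy `s ⊗ 1` applied to `t`; nothing maps into first degree `0`.
  let t' : ∀ p q, C.X p ⊗[K] D.X q := fun p q => match p with
    | 0 => 0
    | p + 1 => (s p).rTensor _ (t p q)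
  -- Applying `s ⊗ 1` to the cycle condition trades `s ⊗ d` for `s d ⊗ 1`. The boundary of `t'` is
  -- therefore `(d s + s d) ⊗ 1` applied to `t`, that is, `t - (P ⊗ 1) t`.
  have hA : ∀ p q, p + q = n → (-1 : K) ^ p • (D.d (q + 1) q).hom.lTensor _ (t' p (q + 1)) =
      (e p).rTensor _ (t p q) := by
    rintro (_ | p) q hpq
    · rw [he0, LinearMap.rTensor_zero, LinearMap.zero_apply]
      exact (congrArg _ (map_zero _)).trans (smul_zero _)
    · have h1 := congrArg ((s p).rTensor (D.X q)) (ht p q (by omega))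
      rw [map_add, map_zero, map_smul] at h1
      have h2 : (s p).rTensor (D.X q) ((D.d (q + 1) q).hom.lTensor (C.X p) (t p (q + 1))) =
          (D.d (q + 1) q).hom.lTensor _ ((s p).rTensor _ (t p (q + 1))) := by
        rw [← LinearMap.comp_apply, ← LinearMap.comp_apply, LinearMap.rTensor_comp_lTensor,
          LinearMap.lTensor_comp_rTensor]
      have h3 : (e (p + 1)).rTensor (D.X q) (t (p + 1) q) =
          (s p).rTensor (D.X q) ((C.d (p + 1) p).hom.rTensor (D.X q) (t (p + 1) q)) := by
        rw [hes, LinearMap.rTensor_comp, LinearMap.comp_apply]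
      rw [h3, eq_neg_of_add_eq_zero_left h1, h2, pow_succ, mul_neg_one, neg_smul]
  -- Since `P d = 0`, applying `P ⊗ 1` to the cycle condition gives `(P ⊗ d) t = 0`, and hence `(P ⊗
  -- r d) t = 0`. So `(P ⊗ 1) t = (P ⊗ N) t`, which lies in the tensor product of the cycles.
  have hB : ∀ p q, p + q = n → (f q).lTensor _ ((P p).rTensor _ (t p q)) = 0 := by
    rintro p (_ | q) hpq
    · rw [hf0, LinearMap.lTensor_zero, LinearMap.zero_apply]
    · have h1 := congrArg ((P p).rTensor (D.X q)) (ht p q (by omega))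
      have h3 : (P p).rTensor (D.X q) ((C.d (p + 1) p).hom.rTensor (D.X q) (t (p + 1) q)) = 0 := by
        rw [← LinearMap.comp_apply, ← LinearMap.rTensor_comp, hPd, LinearMap.rTensor_zero,
          LinearMap.zero_apply]
      rw [map_add, map_zero, map_smul] at h1
      replace h1 := (zero_add _).symm.trans ((congrArg (· + _) h3.symm).trans h1)
      have h2 := (smul_eq_zero.1 h1).resolve_left (pow_ne_zero _ (neg_ne_zero.2 one_ne_zero))
      have h4 : (P p).rTensor (D.X q) ((D.d (q + 1) q).hom.lTensor (C.X p) (t p (q + 1))) =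
          (D.d (q + 1) q).hom.lTensor _ ((P p).rTensor _ (t p (q + 1))) := by
        rw [← LinearMap.comp_apply, ← LinearMap.comp_apply, LinearMap.rTensor_comp_lTensor,
          LinearMap.lTensor_comp_rTensor]
      rw [hfr, LinearMap.lTensor_comp, LinearMap.comp_apply, ← h4]
      exact (congrArg _ h2).trans (map_zero _)
  refine ⟨fun p q => TensorProduct.map ((P p).codRestrict _ (hP p)) ((N q).codRestrict _ (hN q))
    (t p q), t', fun p q hpq => ?_⟩
  have h1 : TensorProduct.map (P p) (N q) (t p q) = (P p).rTensor _ (t p q) := by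
    have : TensorProduct.map (P p) (N q) = (P p).rTensor _ - (f q).lTensor _ ∘ₗ (P p).rTensor _ :=
      TensorProduct.ext' fun a b => by simp [N, TensorProduct.tmul_sub]
    rw [this, LinearMap.sub_apply, LinearMap.comp_apply, hB p q hpq, sub_zero]
  have h2 : TensorProduct.map (cycles C p).subtype (cycles D q).subtype
      (TensorProduct.map ((P p).codRestrict _ (hP p)) ((N q).codRestrict _ (hN q)) (t p q)) =
      TensorProduct.map (P p) (N q) (t p q) := by
    rw [← LinearMap.comp_apply, ← TensorProduct.map_comp]
    rfl
  have h3 : (P p).rTensor (D.X q) (t p q) = t p q -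
      (C.d (p + 1) p).hom.rTensor _ ((s p).rTensor _ (t p q)) - (e p).rTensor _ (t p q) := by
    simp only [P, LinearMap.rTensor_sub, LinearMap.sub_apply, LinearMap.rTensor_id,
      LinearMap.id_apply, LinearMap.rTensor_comp, LinearMap.comp_apply]
  rw [hA p q hpq, h2, h1, h3]
  change (C.d (p + 1) p).hom.rTensor _ ((s p).rTensor _ (t p q)) + _ = _
  abel

/-- The Alexander–Whitney image of `z` is a cycle, hence a sum of tensors of cycles plus a boundary.
Its cross product is homologous to `z` by the natural homotopy; the bounding chain is the cross
product of `t` minus the natural homotopy applied to `z`. -/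
theorem exists_homologous_cross {n : ℕ} (z : cycles (singularChains K (X × Y)) n) :
    ∃ u : ∀ p q : ℕ, cycles (singularChains K X) p ⊗[K] cycles (singularChains K Y) q,
    ∃ c, ((singularChains K (X × Y)).d (n + 1) n).hom c = z -
      ∑ pq ∈ Finset.HasAntidiagonal.antidiagonal n, chainCrossLift pq.1 pq.2 n
        (TensorProduct.map (cycles _ pq.1).subtype (cycles _ pq.2).subtype (u pq.1 pq.2)) := by
  obtain ⟨u, t, ht⟩ := exists_tmul_cycles n (fun p q => alexanderWhitney K X Y p q n z.1) (by
    rintro p q rfl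
    rw [← alexanderWhitney_d rfl, show ((singularChains K (X × Y)).d (p + q + 1) (p + q)).hom z.1 = 0
      from z.2, map_zero])
  obtain ⟨e, he⟩ := exists_natural_homotopy.{u} K n
  refine ⟨u, ∑ pq ∈ Finset.HasAntidiagonal.antidiagonal (n + 1),
    chainCrossLift pq.1 pq.2 (n + 1) (t pq.1 pq.2) - naturalExtension X Y e z.1, ?_⟩
  rw [map_sub, sum_d_chainCrossLift, he X Y z.1 z.2, crossAW_apply,
    Finset.sum_congr rfl fun pq hpq => by
      rw [ht pq.1 pq.2 (Finset.HasAntidiagonal.mem_antidiagonal.1 hpq), map_sub],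
    Finset.sum_sub_distrib]
  abel

end Surjectivity

/-! ### Normalized cocycles -/

section Normalization
variable {K : Type u} [Field K] {X Y : Type u} [TopologicalSpace X] [TopologicalSpace Y]

variable (K X) in
/-- The simplicial vector space of singular chains. -/
def singularSimplicialModule : SimplicialObject (ModuleCat.{u} K) :=
  ((SimplicialObject.whiskering _ _).obj (Limits.sigmaConst.obj (ModuleCat.of K K))).obj
    (TopCat.toSSet.obj (TopCat.of X))

variable (K X) in
/-- The normalization endomorphism of the singular chain complex. -/
def normalize : singularChains K X ⟶ singularChains K X :=
  DoldKan.PInfty (X := singularSimplicialModule K X)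

/-- The Dold–Kan projector is chain homotopic to the identity. -/
theorem homologyMap_normalize (n : ℕ) :
    HomologicalComplex.homologyMap (normalize K X) n = 𝟙 _ :=
  ((DoldKan.homotopyPInftyToId (singularSimplicialModule K X)).homologyMap_eq n).trans
    (HomologicalComplex.homologyMap_id _ _)

/-- The simplex is the pullback of `σ` along a monotone map that identifies the vertices `k` and `k
+ 1`. The Dold–Kan projector annihilates the image of every operator that comes from a non-injective
monotone map. -/
theorem normalize_degenerate {p p' : ℕ} (σ : C(stdSimplex ℝ (Fin (p' + 1)), X)) {g : ℕ → ℕ}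
    (hg : ∀ i j, i ≤ j → j ≤ p → g i ≤ g j) (hp' : g p ≤ p') (k : ℕ) (hk : k < p)
    (hgk : g k = g (k + 1)) :
    ((normalize K X).f p).hom (simplexChain K (σ.comp (vertexMap g p p'))) = 0 := by
  let θ : SimplexCategory.mk p ⟶ SimplexCategory.mk p' := SimplexCategory.mkHom
    ⟨fun k => Fin.ofNat (p' + 1) (g k), fun i j hij => by
      have hj : g j ≤ p' := (hg j p (by omega) le_rfl).trans hp'
      have hi : g i ≤ g j := hg i j hij (by omega)
      rw [Fin.le_def]
      change g i % (p' + 1) ≤ g j % (p' + 1)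
      rwa [Nat.mod_eq_of_lt (by omega), Nat.mod_eq_of_lt (by omega)]⟩
  have hθ : ¬ Mono θ := by
    rw [SimplexCategory.mono_iff_injective]
    intro hinj
    have h1 : θ.toOrderHom ⟨k, hk.trans (Nat.lt_succ_self p)⟩ =
        θ.toOrderHom ⟨k + 1, Nat.succ_lt_succ hk⟩ :=
      congrArg (Fin.ofNat (p' + 1)) hgk
    simpa using hinj h1
  have h1 := DoldKan.degeneracy_comp_PInfty (singularSimplicialModule K X) p θ hθ
  have h2 : (((singularSimplicialModule K X).map θ.op)).hom (simplexChain K σ) =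
      simplexChain K (σ.comp (vertexMap g p p')) := by
    have h3 : Limits.Sigma.ι (fun _ => ModuleCat.of K K)
          (((TopCat.of X).toSSetObjEquiv (.op (.mk p'))).symm σ) ≫
        Limits.Sigma.map' ((TopCat.toSSet.obj (TopCat.of X)).map θ.op) (fun _ => 𝟙 _) =
        𝟙 _ ≫ Limits.Sigma.ι (fun _ => ModuleCat.of K K) _ := Limits.Sigma.ι_comp_map' _ _ _
    rw [Category.id_comp] at h3
    exact congrArg (fun f => f.hom (1 : K)) h3
  rw [← h2]
  exact congrArg (fun f => f.hom (simplexChain K σ)) h1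

/-- A linear form on singular chains is normalized if it vanishes on degenerate simplices. -/
def IsNormalized {p : ℕ} (φ : (singularChains K X).X p →ₗ[K] K) : Prop :=
  ∀ (p' : ℕ) (σ : C(stdSimplex ℝ (Fin (p' + 1)), X)) (g : ℕ → ℕ),
    (∀ i j, i ≤ j → j ≤ p → g i ≤ g j) → g p ≤ p' → ∀ k < p, g k = g (k + 1) →
    φ (simplexChain K (σ.comp (vertexMap g p p'))) = 0

/-- Linear forms on homology are represented by normalized cocycles. -/
theorem exists_normalized_cocycle {p : ℕ} (f : SingularHomology K X p →ₗ[K] K) :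
    ∃ φ : (singularChains K X).X p →ₗ[K] K, IsNormalized φ ∧
      (∀ c, φ (((singularChains K X).d (p + 1) p).hom c) = 0) ∧
      ∀ z : cycles (singularChains K X) p, φ z = f (homologyClass _ p z) := by
  -- Any extension of `f` from cycles to chains will do: composition with the normalization makes it
  -- vanish on degenerate simplices and keeps its values on cycles, because normalization preserves
  -- homology classes.
  obtain ⟨φ, hφ⟩ := (f ∘ₗ homologyClass (singularChains K X) p).exists_extend
  have h1 : ∀ z : cycles (singularChains K X) p, φ z = f (homologyClass _ p z) :=
    fun z => congrArg (fun h => h z) hφ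
  have h2 : ∀ z : cycles (singularChains K X) p, φ (((normalize K X).f p).hom z) =
      f (homologyClass _ p z) := fun z => by
    refine (h1 ⟨_, chain_map_mem_cycles (normalize K X) z.2⟩).trans ?_
    rw [← homologyMap_homologyClass, homologyMap_normalize]
    rfl
  refine ⟨φ ∘ₗ ((normalize K X).f p).hom, fun p' σ g hg hp' k hk hgk => ?_, fun c => ?_, h2⟩
  · rw [LinearMap.comp_apply, normalize_degenerate σ hg hp' k hk hgk, map_zero]
  · refine (h2 ⟨_, d_mem_cycles p c⟩).trans ?_
    rw [(homologyClass_eq_zero_iff _ _ _).2 ⟨c, rfl⟩, map_zero]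

/-! ### Evaluating normalized cocycles on cross products -/

theorem vertexMap_comp_vertexMap (f g : ℕ → ℕ) (p n r : ℕ) (hg : ∀ k ≤ p, g k ≤ n) :
    (vertexMap f n r).comp (vertexMap g p n) = vertexMap (fun k => f (g k)) p r := by
  ext x : 1
  simp only [vertexMap, ContinuousMap.comp_apply, ContinuousMap.coe_mk]
  rw [stdSimplex.map_comp_apply]
  congr 1
  funext k
  simp only [Function.comp]
  congr 2
  exact Nat.mod_eq_of_lt (Nat.lt_succ_iff.2 (hg k (by omega)))

theorem pathX_mono (μ : Finset ℕ) {i j : ℕ} (h : i ≤ j) : pathX μ i ≤ pathX μ j :=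
  Finset.card_le_card (Finset.inter_subset_inter_left (Finset.range_mono h))

theorem pathY_mono (μ : Finset ℕ) {i j : ℕ} (h : i ≤ j) : pathY μ i ≤ pathY μ j :=
  Finset.card_le_card (Finset.sdiff_subset_sdiff (Finset.range_mono h) subset_rfl)

theorem pathX_succ_of_notMem {μ : Finset ℕ} {j : ℕ} (h : j ∉ μ) :
    pathX μ j = pathX μ (j + 1) := by
  rw [pathX, pathX, Finset.range_add_one, Finset.inter_insert_of_notMem h]

theorem pathY_succ_of_mem {μ : Finset ℕ} {j : ℕ} (h : j ∈ μ) : pathY μ j = pathY μ (j + 1) := by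
  rw [pathY, pathY, Finset.range_add_one, Finset.insert_sdiff_of_mem _ h]

/-- The linear form on the tensor product given by two linear forms. -/
def pairing {V W : Type u} [AddCommGroup V] [Module K V] [AddCommGroup W] [Module K W]
    (φ : V →ₗ[K] K) (ψ : W →ₗ[K] K) : V ⊗[K] W →ₗ[K] K :=
  LinearMap.mul' K K ∘ₗ TensorProduct.map φ ψ

theorem pairing_tmul {V W : Type u} [AddCommGroup V] [Module K V] [AddCommGroup W] [Module K W]
    (φ : V →ₗ[K] K) (ψ : W →ₗ[K] K) (v : V) (w : W) : pairing φ ψ (v ⊗ₜ[K] w) = φ v * ψ w := rfl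

/-- The only path not killed is the one with `p` horizontal steps followed by vertical ones. A
vertical step before time `p` repeats a vertex of the front face in `X`, so `φ` vanishes; if there
is none, `μ` properly contains `Finset.range p`, and a horizontal step after time `p` repeats a
vertex of the back face in `Y`, so `ψ` vanishes. -/
theorem pairing_alexanderWhitney_shuffle {p q p' q' n : ℕ} (h : p + q = n) (h' : p' + q' = n)
    {φ : (singularChains K X).X p →ₗ[K] K} {ψ : (singularChains K Y).X q →ₗ[K] K}
    (hφ : IsNormalized φ) (hψ : IsNormalized ψ) (σ : C(stdSimplex ℝ (Fin (p' + 1)), X))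
    (τ : C(stdSimplex ℝ (Fin (q' + 1)), Y)) {μ : Finset ℕ}
    (hμ : μ ∈ Finset.powersetCard p' (Finset.range n)) (hne : μ ≠ Finset.range p) :
    pairing φ ψ (alexanderWhitney K X Y p q n (simplexChain K
      ((σ.comp (vertexMap (pathX μ) n p')).prodMk (τ.comp (vertexMap (pathY μ) n q'))))) = 0 := by
  rw [Finset.mem_powersetCard] at hμ
  have hY := (path_card hμ.1).2
  rw [alexanderWhitney_simplexChain, pairing_tmul]
  change φ (simplexChain K ((σ.comp (vertexMap (pathX μ) n p')).comp _)) *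
    ψ (simplexChain K ((τ.comp (vertexMap (pathY μ) n q')).comp _)) = 0
  rw [ContinuousMap.comp_assoc, ContinuousMap.comp_assoc,
    vertexMap_comp_vertexMap _ _ _ _ _ fun k hk => by omega,
    vertexMap_comp_vertexMap _ _ _ _ _ fun k hk => by omega]
  by_cases h1 : ∃ j < p, j ∉ μ
  · obtain ⟨j, hj, hjμ⟩ := h1
    rw [hφ p' σ _ (fun _ _ hij _ => pathX_mono μ hij)
      (hμ.2 ▸ Finset.card_le_card Finset.inter_subset_left) j hj (pathX_succ_of_notMem hjμ),
      zero_mul]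
  · push Not at h1
    have h2 : ∃ j ∈ μ, p ≤ j := by
      by_contra! h2
      exact hne (Finset.ext fun j => ⟨fun hj => Finset.mem_range.2 (h2 j hj),
        fun hj => h1 j (Finset.mem_range.1 hj)⟩)
    obtain ⟨j, hjμ, hj⟩ := h2
    have hjn := Finset.mem_range.1 (hμ.1 hjμ)
    rw [hψ q' τ (fun k => pathY μ (k + p)) (fun _ _ hij _ => pathY_mono μ (by omega))
      (by simp only [show q + p = n by omega, hY, hμ.2]; omega) (j - p) (by omega) (by
        simp only [show j - p + p = j by omega, show j - p + 1 + p = j + 1 by omega]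
        exact pathY_succ_of_mem hjμ), mul_zero]

/-- A shuffle with `p' ≠ p` horizontal steps is never `Finset.range p`, so every term vanishes. -/
theorem pairing_alexanderWhitney_cross_of_ne {p q p' q' n : ℕ} (h : p + q = n) (h' : p' + q' = n)
    (hp : p ≠ p') {φ : (singularChains K X).X p →ₗ[K] K} {ψ : (singularChains K Y).X q →ₗ[K] K}
    (hφ : IsNormalized φ) (hψ : IsNormalized ψ) (a : (singularChains K X).X p')
    (b : (singularChains K Y).X q') :
    pairing φ ψ (alexanderWhitney K X Y p q n (chainCross K p' q' n a b)) = 0 := by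
  have key : (chainCross K (X := X) (Y := Y) p' q' n).compr₂
      (pairing φ ψ ∘ₗ alexanderWhitney K X Y p q n) = 0 := by
    refine chain_hom_ext fun σ => chain_hom_ext fun τ => ?_
    rw [LinearMap.compr₂_apply, LinearMap.comp_apply, cross_simplex, shuffleProduct, map_sum,
      map_sum]
    refine Finset.sum_eq_zero fun μ hμ => ?_
    rw [map_smul, map_smul, pairing_alexanderWhitney_shuffle h h' hφ hψ σ τ hμ, smul_zero]
    rintro rfl
    exact hp (by simpa using (Finset.mem_powersetCard.1 hμ).2)
  exact congrArg (fun f => f a b) key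

theorem vertexMap_eq_id (f : ℕ → ℕ) (n : ℕ) (hf : ∀ k ≤ n, f k = k) :
    vertexMap f n n = ContinuousMap.id _ := by
  have : (fun k : Fin (n + 1) => Fin.ofNat (n + 1) (f k)) = id := funext fun k => by
    rw [hf k (by omega)]
    exact Fin.ext (Nat.mod_eq_of_lt k.2)
  ext x : 1
  simp only [vertexMap, ContinuousMap.coe_mk, this]
  exact stdSimplex.map_id_apply x

/-- Only the shuffle `Finset.range p` survives. Its sign is `1`, its front face is `σ` and its back
face is `τ`. -/
theorem pairing_alexanderWhitney_cross {p q n : ℕ} (h : p + q = n)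
    {φ : (singularChains K X).X p →ₗ[K] K} {ψ : (singularChains K Y).X q →ₗ[K] K}
    (hφ : IsNormalized φ) (hψ : IsNormalized ψ) (a : (singularChains K X).X p)
    (b : (singularChains K Y).X q) :
    pairing φ ψ (alexanderWhitney K X Y p q n (chainCross K p q n a b)) = φ a * ψ b := by
  have key : (chainCross K (X := X) (Y := Y) p q n).compr₂
      (pairing φ ψ ∘ₗ alexanderWhitney K X Y p q n) = (LinearMap.mul K K).compl₁₂ φ ψ := by
    refine chain_hom_ext fun σ => chain_hom_ext fun τ => ?_
    rw [LinearMap.compr₂_apply, LinearMap.comp_apply, cross_simplex, shuffleProduct, map_sum,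
      map_sum, Finset.sum_eq_single (Finset.range p)]
    · have hX : ∀ k ≤ p, pathX (Finset.range p) k = k := fun k hk => by
        rw [pathX, Finset.inter_eq_right.2 (Finset.range_mono hk), Finset.card_range]
      have hY : ∀ k, pathY (Finset.range p) (k + p) = k := fun k => by
        rw [pathY, Finset.card_sdiff_of_subset (Finset.range_mono (by omega)), Finset.card_range,
          Finset.card_range]
        omega
      have hs : ∑ j ∈ Finset.range p, pathY (Finset.range p) j = 0 :=
        Finset.sum_eq_zero fun j hj => by
          rw [pathY, Finset.sdiff_eq_empty_iff_subset.2
            (Finset.range_mono (Finset.mem_range.1 hj).le), Finset.card_empty]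
      rw [hs, pow_zero, one_smul, alexanderWhitney_simplexChain, pairing_tmul]
      change φ (simplexChain K ((σ.comp (vertexMap _ n p)).comp _)) *
        ψ (simplexChain K ((τ.comp (vertexMap _ n q)).comp _)) =
        φ (simplexChain K σ) * ψ (simplexChain K τ)
      rw [ContinuousMap.comp_assoc, ContinuousMap.comp_assoc,
        vertexMap_comp_vertexMap _ _ _ _ _ fun k hk => by omega,
        vertexMap_comp_vertexMap _ _ _ _ _ fun k hk => by omega,
        vertexMap_eq_id _ p hX, vertexMap_eq_id _ q fun k _ => hY k, ContinuousMap.comp_id,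
        ContinuousMap.comp_id]
    · intro μ hμ hne
      rw [map_smul, map_smul, pairing_alexanderWhitney_shuffle h h hφ hψ σ τ hμ hne, smul_zero]
    · intro hn
      exact absurd (Finset.mem_powersetCard.2 ⟨Finset.range_mono (by omega), Finset.card_range p⟩) hn
  exact congrArg (fun f => f a b) key

end Normalization

/-! ### The Künneth theorem -/

section Kunneth
variable (K : Type u) [Field K] (X Y : Type u) [TopologicalSpace X] [TopologicalSpace Y]

/-- The cross product `⨁_{p + q = n} H_p(X) ⊗ H_q(Y) → H_n(X × Y)`. -/
def totalCross (n : ℕ) : GradedTensor K (fun i => SingularHomology K X i)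
    (fun i => SingularHomology K Y i) n →ₗ[K] SingularHomology K (X × Y) n :=
  DirectSum.toModule K {pq : ℕ × ℕ // pq.1 + pq.2 = n} (SingularHomology K (X × Y) n)
    fun pq => TensorProduct.lift (homologyCross K X Y pq.2)

variable {K X Y}

theorem totalCross_lof {n : ℕ} (pq : {pq : ℕ × ℕ // pq.1 + pq.2 = n})
    (a : SingularHomology K X pq.1.1) (b : SingularHomology K Y pq.1.2) :
    totalCross K X Y n (DirectSum.lof K {pq : ℕ × ℕ // pq.1 + pq.2 = n}
      (fun pq => SingularHomology K X pq.1.1 ⊗[K] SingularHomology K Y pq.1.2) pq (a ⊗ₜ[K] b)) =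
      homologyCross K X Y pq.2 a b := by
  rw [totalCross, DirectSum.toModule_lof, TensorProduct.lift.tmul]

theorem totalCross_surjective (n : ℕ) : Function.Surjective (totalCross K X Y n) := by
  intro x
  obtain ⟨z, rfl⟩ := homologyClass_surjective _ n x
  -- The cycles whose class is in the range, viewed as a subspace of the chains, so that `z` can be
  -- decomposed without first proving the summands to be cycles.
  let R : Submodule K ((singularChains K (X × Y)).X n) :=
    ((LinearMap.range (totalCross K X Y n)).comap
      (homologyClass (singularChains K (X × Y)) n)).map (cycles _ n).subtype
  suffices z.1 ∈ R by
    obtain ⟨z', ⟨y, hy⟩, hz'⟩ := this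
    exact ⟨y, hy.trans (congrArg _ (Subtype.ext hz'))⟩
  obtain ⟨u, c, hc⟩ := exists_homologous_cross z
  rw [← sub_add_cancel z.1, ← hc]
  refine R.add_mem ⟨⟨_, d_mem_cycles n c⟩, ?_, rfl⟩ (R.sum_mem fun pq hpq => ?_)
  · rw [SetLike.mem_coe, Submodule.mem_comap, (homologyClass_eq_zero_iff _ _ _).2 ⟨c, rfl⟩]
    exact zero_mem _
  · obtain ⟨p, q⟩ := pq
    replace hpq : p + q = n := Finset.HasAntidiagonal.mem_antidiagonal.1 hpq
    generalize u (p, q).1 (p, q).2 = t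
    induction t with
    | zero => rw [map_zero, map_zero]; exact R.zero_mem
    | add t t' ht ht' => rw [map_add, map_add]; exact R.add_mem ht ht'
    | tmul a b =>
      refine ⟨⟨_, cross_mem_cycles hpq a.2 b.2⟩, ⟨_, (totalCross_lof ⟨(p, q), hpq⟩
        (homologyClass _ p a) (homologyClass _ q b)).trans ?_⟩, rfl⟩
      exact homologyCross_class hpq a b

/-- Linear forms of the tensor product given by pairs of linear forms separate its elements. -/
theorem eq_zero_of_pairing_eq_zero {V W : Type u} [AddCommGroup V] [Module K V] [AddCommGroup W]
    [Module K W] (t : V ⊗[K] W) (h : ∀ (f : V →ₗ[K] K) (g : W →ₗ[K] K), pairing f g t = 0) :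
    t = 0 := by
  let b := Module.Basis.ofVectorSpace K V
  let c := Module.Basis.ofVectorSpace K W
  refine (b.tensorProduct c).repr.map_eq_zero_iff.1 (Finsupp.ext fun ij => ?_)
  rw [Finsupp.zero_apply, ← h (b.coord ij.1) (c.coord ij.2)]
  have key : (b.tensorProduct c).coord ij = pairing (b.coord ij.1) (c.coord ij.2) := by
    refine TensorProduct.ext' fun v w => ?_
    rw [pairing_tmul, Module.Basis.coord_apply, Module.Basis.tensorProduct_repr_tmul_apply]
    simp [mul_comm]
  exact congrArg (fun f => f t) key

theorem totalCross_injective (n : ℕ) : Function.Injective (totalCross K X Y n) := by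
  rw [injective_iff_map_eq_zero]
  intro x hx
  refine DFinsupp.ext fun pq => eq_zero_of_pairing_eq_zero _ fun f g => ?_
  obtain ⟨φ, hφ, hφd, hφf⟩ := exists_normalized_cocycle f
  obtain ⟨ψ, hψ, hψd, hψg⟩ := exists_normalized_cocycle g
  -- `Φ` represents the cohomology cross product of `f` and `g`. It vanishes on boundaries, hence
  -- induces `Ψ`, whose composition with the cross product is `f ⊗ g` on the component `pq` (`key`).
  let Φ := pairing φ ψ ∘ₗ alexanderWhitney K X Y pq.1.1 pq.1.2 n
  have hΦ : ∀ c, Φ (((singularChains K (X × Y)).d (n + 1) n).hom c) = 0 := fun c => by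
    have h1 : pairing φ ψ ∘ₗ ((singularChains K X).d (pq.1.1 + 1) pq.1.1).hom.rTensor _ = 0 :=
      TensorProduct.ext' fun a b => by
        rw [LinearMap.comp_apply, LinearMap.rTensor_tmul, pairing_tmul, hφd, zero_mul]; rfl
    have h2 : pairing φ ψ ∘ₗ ((singularChains K Y).d (pq.1.2 + 1) pq.1.2).hom.lTensor _ = 0 :=
      TensorProduct.ext' fun a b => by
        rw [LinearMap.comp_apply, LinearMap.lTensor_tmul, pairing_tmul, hψd, mul_zero]; rfl
    rw [LinearMap.comp_apply, alexanderWhitney_d pq.2, map_add, map_smul]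
    have e1 := fun t => congrArg (fun f => f t) h1
    have e2 := fun t => congrArg (fun f => f t) h2
    exact (congrArg₂ (fun x y => x + (-1 : K) ^ pq.1.1 • y) (e1 _) (e2 _)).trans (by simp)
  let Ψ : SingularHomology K (X × Y) n →ₗ[K] K := descend
    (homologyClass (singularChains K (X × Y)) n) (homologyClass_surjective _ n)
    (Φ ∘ₗ (cycles _ n).subtype) fun z hz => by
      obtain ⟨c, hc⟩ := (homologyClass_eq_zero_iff _ _ _).1 hz
      rw [LinearMap.comp_apply, Submodule.subtype_apply, ← hc, hΦ]
  have hΨ : ∀ z, Ψ (homologyClass _ n z) = Φ z.1 := fun z => descend_apply _ _ _ _ z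
  have key : Ψ ∘ₗ totalCross K X Y n = pairing f g ∘ₗ DirectSum.component K _ _ pq := by
    refine DirectSum.linearMap_ext _ fun pq' => TensorProduct.ext' fun a b => ?_
    obtain ⟨a, rfl⟩ := homologyClass_surjective _ _ a
    obtain ⟨b, rfl⟩ := homologyClass_surjective _ _ b
    rw [LinearMap.comp_apply, LinearMap.comp_apply, LinearMap.comp_apply, LinearMap.comp_apply,
      totalCross_lof, homologyCross_class, hΨ]
    by_cases hpq : pq' = pq
    · subst hpq
      rw [DirectSum.component.lof_self, pairing_tmul, ← hφf, ← hψg]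
      exact pairing_alexanderWhitney_cross pq'.2 hφ hψ a.1 b.1
    · rw [DirectSum.component.of, dif_neg hpq, map_zero]
      refine pairing_alexanderWhitney_cross_of_ne pq.2 pq'.2 (fun hp => hpq ?_) hφ hψ a.1 b.1
      have h1 := pq.2
      have h2 := pq'.2
      exact Subtype.ext (Prod.ext hp.symm (by omega))
  have h1 := congrArg (fun h => h x) key
  simp only [LinearMap.comp_apply, hx, map_zero] at h1
  exact h1.symm

end Kunneth

/-! ### Bilinear relations -/

section Relations
variable {K : Type u} [Field K] {ι : Type} [Add ι] [DecidableEq ι] {V : ι → Type u}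
  [∀ i, AddCommGroup (V i)] [∀ i, Module K (V i)]

/-- The relation defined by the span of the tensors `v ⊗ w` of related elements. -/
theorem generatedRel_iff_definedRel (r : (Σ i, V i) → (Σ i, V i) → Prop) (v w : Σ i, V i) :
    generatedRel K r v w ↔
      definedRel K (gradedSpan K {x | ∃ a b, r a b ∧ x = tmul K a b}) v w := by
  constructor
  · intro h
    exact h _ ⟨_, fun _ _ => Iff.rfl⟩ fun a b hab => Submodule.subset_span ⟨a, b, hab, rfl⟩
  · rintro h s ⟨R, hR⟩ hs
    refine (hR v w).2 (Submodule.span_le.2 ?_ h)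
    rintro x ⟨a, b, hab, hx⟩
    have := (hR a b).1 (hs a b hab)
    rw [definedRel, ← hx] at this
    exact this

/-- Membership of a tensor in a span of tensors may be tested in one bidegree. -/
theorem definedRel_gradedSpan_iff (r : (Σ i, V i) → (Σ i, V i) → Prop) (v w : Σ i, V i) :
    definedRel K (gradedSpan K {x | ∃ a b, r a b ∧ x = tmul K a b}) v w ↔
      v.2 ⊗ₜ[K] w.2 ∈ Submodule.span K
        {t : V v.1 ⊗[K] V w.1 | ∃ a b, r ⟨v.1, a⟩ ⟨w.1, b⟩ ∧ t = a ⊗ₜ[K] b} := by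
  obtain ⟨i, v⟩ := v
  obtain ⟨j, w⟩ := w
  constructor
  · intro h
    -- Projection to the summand `(i, j)` keeps the generators of that bidegree and kills the others
    -- of the same total degree.
    have h1 := Submodule.mem_map_of_mem (f := DirectSum.component K {ij : ι × ι // ij.1 + ij.2 = i + j}
      (fun ij => V ij.1.1 ⊗[K] V ij.1.2) ⟨(i, j), rfl⟩) h
    simp only [tmul, DirectSum.component.lof_self] at h1
    refine (Submodule.map_le_iff_le_comap.2 (Submodule.span_le.2 ?_)) h1
    rintro x ⟨⟨k, a⟩, ⟨l, b⟩, hab, hx⟩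
    have hkl : i + j = k + l := congrArg Sigma.fst hx
    have hx' : x = DirectSum.lof K {ij : ι × ι // ij.1 + ij.2 = i + j}
        (fun ij => V ij.1.1 ⊗[K] V ij.1.2) ⟨(k, l), hkl.symm⟩ (a ⊗ₜ[K] b) := by
      clear h1 h
      revert x
      -- The total degree has to become a variable before the equality of degrees can be substituted
      -- in the type of `x`.
      generalize i + j = m at *
      intro x hx
      subst hkl
      exact eq_of_heq (Sigma.mk.inj hx).2
    rw [hx', SetLike.mem_coe, Submodule.mem_comap]
    by_cases hk : (k, l) = (i, j)
    · obtain ⟨rfl, rfl⟩ := Prod.mk.inj hk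
      rw [DirectSum.component.lof_self]
      exact Submodule.subset_span ⟨a, b, hab, rfl⟩
    · rw [DirectSum.component.of, dif_neg fun h => hk (congrArg Subtype.val h)]
      exact zero_mem _
  · intro h
    have h1 := Submodule.mem_map_of_mem (f := DirectSum.lof K {ij : ι × ι // ij.1 + ij.2 = i + j}
      (fun ij => V ij.1.1 ⊗[K] V ij.1.2) ⟨(i, j), rfl⟩) h
    refine (Submodule.map_le_iff_le_comap.2 (Submodule.span_le.2 ?_)) h1
    rintro t ⟨a, b, hab, rfl⟩
    exact Submodule.subset_span ⟨⟨i, a⟩, ⟨j, b⟩, hab, rfl⟩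

end Relations

/-! ### Pointing relations and cross products -/

section Pointing
variable {K : Type u} [Field K] {X Y X' Y' : Type u} [TopologicalSpace X] [TopologicalSpace Y]
  [TopologicalSpace X'] [TopologicalSpace Y']

theorem pushHomology_homologyCross (f : C(X, X')) (g : C(Y, Y')) {p q n : ℕ} (h : p + q = n)
    (a : SingularHomology K X p) (b : SingularHomology K Y q) :
    pushHomology K (f.prodMap g) n (homologyCross K X Y h a b) =
      homologyCross K X' Y' h (pushHomology K f p a) (pushHomology K g q b) := by
  obtain ⟨a, rfl⟩ := homologyClass_surjective _ _ a
  obtain ⟨b, rfl⟩ := homologyClass_surjective _ _ b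
  rw [homologyCross_class, pushHomology_homologyClass, pushHomology_homologyClass,
    pushHomology_homologyClass, homologyCross_class]
  exact congrArg _ (Subtype.ext (push_chainCross f g p q n a.1 b.1))

/-- Classes that come from `A` and `B` have a cross product that comes from `A × B`. -/
theorem homologyCross_mem_range_inclusionMap {A : Set X} {B : Set Y} {p q n : ℕ} (h : p + q = n)
    {a : SingularHomology K X p} {b : SingularHomology K Y q}
    (ha : a ∈ LinearMap.range (inclusionMap K A p)) (hb : b ∈ LinearMap.range (inclusionMap K B q)) :
    homologyCross K X Y h a b ∈ LinearMap.range (inclusionMap K (A ×ˢ B) n) := by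
  obtain ⟨a, rfl⟩ := ha
  obtain ⟨b, rfl⟩ := hb
  refine ⟨pushHomology K (⟨fun x => ⟨(x.1.1, x.2.1), x.1.2, x.2.2⟩, by fun_prop⟩ :
    C(A × B, (A ×ˢ B : Set (X × Y)))) n (homologyCross K A B h a b), ?_⟩
  rw [inclusionMap_eq, ← LinearMap.comp_apply, ← pushHomology_comp, inclusionMap_eq,
    inclusionMap_eq, ← pushHomology_homologyCross]
  rfl

/-- A class that comes from a subspace `E` of the product is a combination of cross products of
classes that come from the projections of `E`. -/
theorem exists_totalCross_eq_of_mem_range {E : Set (X × Y)} {n : ℕ} {α : SingularHomology K (X × Y) n}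
    (hα : α ∈ LinearMap.range (inclusionMap K E n)) :
    ∃ t ∈ Submodule.span K {t | ∃ (pq : {pq : ℕ × ℕ // pq.1 + pq.2 = n}),
        ∃ a ∈ LinearMap.range (inclusionMap K (Prod.fst '' E) pq.1.1),
        ∃ b ∈ LinearMap.range (inclusionMap K (Prod.snd '' E) pq.1.2),
        t = DirectSum.lof K {pq : ℕ × ℕ // pq.1 + pq.2 = n}
          (fun pq => SingularHomology K X pq.1.1 ⊗[K] SingularHomology K Y pq.1.2) pq (a ⊗ₜ[K] b)},
      totalCross K X Y n t = α := by
  obtain ⟨α, rfl⟩ := hα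
  let A : Set X := Prod.fst '' E
  let B : Set Y := Prod.snd '' E
  let j : C(E, A × B) := ⟨fun x => (⟨x.1.1, x.1, x.2, rfl⟩, ⟨x.1.2, x.1, x.2, rfl⟩), by fun_prop⟩
  let f : C(A, X) := ⟨Subtype.val, continuous_subtype_val⟩
  let g : C(B, Y) := ⟨Subtype.val, continuous_subtype_val⟩
  -- The inclusion of `E` factors through the product of its projections, where the Künneth theorem
  -- is applied; naturality then carries the decomposition to `X × Y`.
  have h1 : inclusionMap K E n = pushHomology K (f.prodMap g) n ∘ₗ pushHomology K j n := by
    rw [← pushHomology_comp]; rfl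
  obtain ⟨t, ht⟩ := totalCross_surjective n (pushHomology K j n α)
  rw [h1, LinearMap.comp_apply, ← ht]
  clear ht
  induction t using DirectSum.induction_on with
  | zero => exact ⟨0, zero_mem _, by simp only [map_zero]⟩
  | add t t' ht ht' =>
    obtain ⟨s, hs, hst⟩ := ht
    obtain ⟨s', hs', hst'⟩ := ht'
    exact ⟨s + s', add_mem hs hs', by simp only [map_add, hst, hst']⟩
  | of pq t =>
    induction t with
    | zero => exact ⟨0, zero_mem _, by simp only [map_zero]⟩
    | add t t' ht ht' =>
      obtain ⟨s, hs, hst⟩ := ht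
      obtain ⟨s', hs', hst'⟩ := ht'
      exact ⟨s + s', add_mem hs hs', by simp only [map_add, hst, hst']⟩
    | tmul a b =>
      refine ⟨_, Submodule.subset_span ⟨pq, inclusionMap K A _ a, ⟨a, rfl⟩, inclusionMap K B _ b,
        ⟨b, rfl⟩, rfl⟩, ?_⟩
      rw [totalCross_lof]
      exact ((congrArg _ (totalCross_lof pq a b)).trans
        (pushHomology_homologyCross f g pq.2 a b)).symm

/-! ### Edges under the cross product and its inverse -/

variable [Preorder X] [Preorder Y]

/-- The elements of `H_i(X) ⊗ H_j(X)` spanned by the edges. -/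
def edgeSpan (K : Type u) [Field K] (X : Type u) [TopologicalSpace X] [Preorder X] (i j : ℕ) :
    Submodule K (SingularHomology K X i ⊗[K] SingularHomology K X j) :=
  Submodule.span K {t | ∃ a b, HomologyEdge K X ⟨i, a⟩ ⟨j, b⟩ ∧ t = a ⊗ₜ[K] b}

theorem homologyDigraph_pointsTo_iff (v w : Σ i, SingularHomology K X i) :
    (homologyDigraph K X).PointsTo v w ↔ v.2 ⊗ₜ[K] w.2 ∈ edgeSpan K X v.1 w.1 :=
  (generatedRel_iff_definedRel (HomologyEdge K X) v w).trans (definedRel_gradedSpan_iff _ v w)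

/-- The generating relation of the pointing relation of a tensor product of homology digraphs. -/
def TensorEdge (K : Type u) [Field K] (X Y : Type u) [TopologicalSpace X] [TopologicalSpace Y]
    [Preorder X] [Preorder Y] (A B : Σ n, GradedTensor K (fun i => SingularHomology K X i)
      (fun i => SingularHomology K Y i) n) : Prop :=
  ∃ v v' w w', (homologyDigraph K X).PointsTo v v' ∧ (homologyDigraph K Y).PointsTo w w' ∧
    A = tmul K v w ∧ B = tmul K v' w'

/-- The elements of the tensor square of `H_*(X) ⊗ H_*(Y)` spanned by the generating relation, in
one bidegree. -/
def tensorEdgeSpan (K : Type u) [Field K] (X Y : Type u) [TopologicalSpace X] [TopologicalSpace Y]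
    [Preorder X] [Preorder Y] (m m' : ℕ) : Submodule K
      (GradedTensor K (fun i => SingularHomology K X i) (fun i => SingularHomology K Y i) m ⊗[K]
        GradedTensor K (fun i => SingularHomology K X i) (fun i => SingularHomology K Y i) m') :=
  Submodule.span K {t | ∃ a b, TensorEdge K X Y ⟨m, a⟩ ⟨m', b⟩ ∧ t = a ⊗ₜ[K] b}

theorem tensor_pointsTo_iff (A B : Σ n, GradedTensor K (fun i => SingularHomology K X i)
      (fun i => SingularHomology K Y i) n) :
    ((homologyDigraph K X).tensor (homologyDigraph K Y)).PointsTo A B ↔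
      A.2 ⊗ₜ[K] B.2 ∈ tensorEdgeSpan K X Y A.1 B.1 := by
  refine Iff.trans ?_ (definedRel_gradedSpan_iff (TensorEdge K X Y) A B)
  change definedRel K (gradedSpan K _) A B ↔ _
  have : {x | ∃ v v' w w', (homologyDigraph K X).PointsTo v v' ∧
      (homologyDigraph K Y).PointsTo w w' ∧ x = tmul K (tmul K v w) (tmul K v' w')} =
      {x | ∃ a b, TensorEdge K X Y a b ∧ x = tmul K a b} := by
    ext x
    constructor
    · rintro ⟨v, v', w, w', hv, hw, rfl⟩
      exact ⟨_, _, ⟨v, v', w, w', hv, hw, rfl, rfl⟩, rfl⟩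
    · rintro ⟨_, _, ⟨v, v', w, w', hv, hw, rfl, rfl⟩, rfl⟩
      exact ⟨v, v', w, w', hv, hw, rfl⟩
  exact iff_of_eq (congrArg (fun s => definedRel K (gradedSpan K s) A B) this)

theorem HomologyEdge.cross {i i' j j' m m' : ℕ} (h : i + j = m) (h' : i' + j' = m')
    {a : SingularHomology K X i} {a' : SingularHomology K X i'} {b : SingularHomology K Y j}
    {b' : SingularHomology K Y j'} (ha : HomologyEdge K X ⟨i, a⟩ ⟨i', a'⟩)
    (hb : HomologyEdge K Y ⟨j, b⟩ ⟨j', b'⟩) :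
    HomologyEdge K (X × Y) ⟨m, homologyCross K X Y h a b⟩ ⟨m', homologyCross K X Y h' a' b'⟩ := by
  obtain ⟨E, F, hE, hF, hEF⟩ := ha
  obtain ⟨E', F', hE', hF', hEF'⟩ := hb
  exact ⟨E ×ˢ E', F ×ˢ F', homologyCross_mem_range_inclusionMap h hE hE',
    homologyCross_mem_range_inclusionMap h' hF hF',
    fun x hx y hy => ⟨hEF _ hx.1 _ hy.1, hEF' _ hx.2 _ hy.2⟩⟩

/-- The middle factors are exchanged to obtain a map `Θ` that is bilinear in the two given tensors.
Both spans may then be replaced by their generators, for which `HomologyEdge.cross` applies. -/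
theorem cross_tmul_cross_mem_edgeSpan {i i' j j' m m' : ℕ} (h : i + j = m) (h' : i' + j' = m')
    {a : SingularHomology K X i} {a' : SingularHomology K X i'} {b : SingularHomology K Y j}
    {b' : SingularHomology K Y j'} (ha : a ⊗ₜ[K] a' ∈ edgeSpan K X i i')
    (hb : b ⊗ₜ[K] b' ∈ edgeSpan K Y j j') :
    homologyCross K X Y h a b ⊗ₜ[K] homologyCross K X Y h' a' b' ∈ edgeSpan K (X × Y) m m' := by
  let Θ : (SingularHomology K X i ⊗[K] SingularHomology K X i') →ₗ[K]
      (SingularHomology K Y j ⊗[K] SingularHomology K Y j') →ₗ[K]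
      (SingularHomology K (X × Y) m ⊗[K] SingularHomology K (X × Y) m') :=
    (TensorProduct.mk K _ _).compr₂
      (TensorProduct.map (TensorProduct.lift (homologyCross K X Y h))
        (TensorProduct.lift (homologyCross K X Y h')) ∘ₗ
        (TensorProduct.tensorTensorTensorComm K (SingularHomology K X i) (SingularHomology K X i')
          (SingularHomology K Y j) (SingularHomology K Y j')).toLinearMap)
  have hΘ : ∀ a a' b b', Θ (a ⊗ₜ[K] a') (b ⊗ₜ[K] b') =
    homologyCross K X Y h a b ⊗ₜ[K] homologyCross K X Y h' a' b' := fun _ _ _ _ => rfl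
  rw [← hΘ]
  have h1 : Θ (a ⊗ₜ[K] a') (b ⊗ₜ[K] b') ∈
      Submodule.map₂ Θ (edgeSpan K X i i') (edgeSpan K Y j j') :=
    Submodule.apply_mem_map₂ Θ ha hb
  rw [edgeSpan, edgeSpan, Submodule.map₂_span_span] at h1
  refine Submodule.span_le.2 ?_ h1
  rintro _ ⟨_, ⟨a, a', haa, rfl⟩, _, ⟨b, b', hbb, rfl⟩, rfl⟩
  exact Submodule.subset_span ⟨_, _, haa.cross h h' hbb, hΘ _ _ _ _⟩

theorem TensorEdge.totalCross_mem_edgeSpan {m m' : ℕ}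
    {A : GradedTensor K (fun i => SingularHomology K X i) (fun i => SingularHomology K Y i) m}
    {B : GradedTensor K (fun i => SingularHomology K X i) (fun i => SingularHomology K Y i) m'}
    (h : TensorEdge K X Y ⟨m, A⟩ ⟨m', B⟩) :
    totalCross K X Y m A ⊗ₜ[K] totalCross K X Y m' B ∈ edgeSpan K (X × Y) m m' := by
  obtain ⟨⟨i, a⟩, ⟨i', a'⟩, ⟨j, b⟩, ⟨j', b'⟩, ha, hb, hA, hB⟩ := h
  cases hA
  cases hB
  have := cross_tmul_cross_mem_edgeSpan (K := K) rfl rfl ((homologyDigraph_pointsTo_iff _ _).1 ha)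
    ((homologyDigraph_pointsTo_iff _ _).1 hb)
  rw [← totalCross_lof ⟨(i, j), rfl⟩, ← totalCross_lof ⟨(i', j'), rfl⟩] at this
  exact this

/-- The cross product as an isomorphism of graded vector spaces. -/
def totalCrossEquiv (K : Type u) [Field K] (X Y : Type u) [TopologicalSpace X]
    [TopologicalSpace Y] (n : ℕ) : GradedTensor K (fun i => SingularHomology K X i)
      (fun i => SingularHomology K Y i) n ≃ₗ[K] SingularHomology K (X × Y) n :=
  LinearEquiv.ofBijective (totalCross K X Y n) ⟨totalCross_injective n, totalCross_surjective n⟩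

theorem HomologyEdge.symm_mem_tensorEdgeSpan {m m' : ℕ} {α : SingularHomology K (X × Y) m}
    {β : SingularHomology K (X × Y) m'} (h : HomologyEdge K (X × Y) ⟨m, α⟩ ⟨m', β⟩) :
    (totalCrossEquiv K X Y m).symm α ⊗ₜ[K] (totalCrossEquiv K X Y m').symm β ∈
      tensorEdgeSpan K X Y m m' := by
  obtain ⟨E, F, hE, hF, hEF⟩ := h
  obtain ⟨s, hs, rfl⟩ := exists_totalCross_eq_of_mem_range (n := m) hE
  obtain ⟨t, ht, rfl⟩ := exists_totalCross_eq_of_mem_range (n := m') hF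
  have hG : ∀ n u, (totalCrossEquiv K X Y n).symm (totalCross K X Y n u) = u := fun n u =>
    (totalCrossEquiv K X Y n).symm_apply_apply u
  rw [hG, hG]
  -- The tensor of two elements of spans lies in the span of the tensors of generators, so both
  -- factors may be taken to be single tensors `a ⊗ b` and `a' ⊗ b'`.
  have h2 := Submodule.apply_mem_map₂ (TensorProduct.mk K _ _) hs ht
  rw [Submodule.map₂_span_span] at h2
  refine Submodule.span_mono ?_ h2
  rintro _ ⟨_, ⟨⟨⟨p, q⟩, hpq⟩, a, ha, b, hb, rfl⟩, _, ⟨⟨⟨p', q'⟩, hpq'⟩, a', ha', b', hb', rfl⟩, rfl⟩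
  dsimp only at hpq hpq'
  subst hpq hpq'
  refine ⟨_, _, ⟨⟨p, a⟩, ⟨p', a'⟩, ⟨q, b⟩, ⟨q', b'⟩, ?_, ?_, rfl, rfl⟩, rfl⟩
  · refine (homologyDigraph_pointsTo_iff _ _).2 (Submodule.subset_span ⟨a, a', ⟨_, _, ha, ha', ?_⟩, rfl⟩)
    -- Points of the projections lift to points of `E` and `F`, and the order of `X × Y` is
    -- componentwise.
    rintro _ ⟨x, hx, rfl⟩ _ ⟨y, hy, rfl⟩
    exact (hEF x hx y hy).1
  · refine (homologyDigraph_pointsTo_iff _ _).2 (Submodule.subset_span ⟨b, b', ⟨_, _, hb, hb', ?_⟩, rfl⟩)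
    rintro _ ⟨x, hx, rfl⟩ _ ⟨y, hy, rfl⟩
    exact (hEF x hx y hy).2

theorem isMorphism_crossProduct : DirectionalSpace.IsMorphism
    ((homologyDigraph K X).tensor (homologyDigraph K Y)) (homologyDigraph K (X × Y))
    (crossProduct K X Y) := by
  rintro ⟨m, A⟩ ⟨m', B⟩ hAB
  have key : tensorEdgeSpan K X Y m m' ≤ (edgeSpan K (X × Y) m m').comap
      (TensorProduct.map (totalCross K X Y m) (totalCross K X Y m')) := by
    refine Submodule.span_le.2 ?_
    rintro _ ⟨A, B, h, rfl⟩
    exact h.totalCross_mem_edgeSpan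
  -- `crossProduct` and `totalCross` agree by definition.
  exact (homologyDigraph_pointsTo_iff ⟨m, totalCross K X Y m A⟩ ⟨m', totalCross K X Y m' B⟩).2
    (key ((tensor_pointsTo_iff ⟨m, A⟩ ⟨m', B⟩).1 hAB))

theorem isMorphism_totalCrossEquiv_symm : DirectionalSpace.IsMorphism
    (homologyDigraph K (X × Y)) ((homologyDigraph K X).tensor (homologyDigraph K Y))
    (fun n => (totalCrossEquiv K X Y n).symm.toLinearMap) := by
  rintro ⟨m, α⟩ ⟨m', β⟩ hαβ
  have key : edgeSpan K (X × Y) m m' ≤ (tensorEdgeSpan K X Y m m').comap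
      (TensorProduct.map (totalCrossEquiv K X Y m).symm.toLinearMap
        (totalCrossEquiv K X Y m').symm.toLinearMap) := by
    refine Submodule.span_le.2 ?_
    rintro _ ⟨α, β, h, rfl⟩
    exact h.symm_mem_tensorEdgeSpan
  exact (tensor_pointsTo_iff ⟨m, (totalCrossEquiv K X Y m).symm α⟩
    ⟨m', (totalCrossEquiv K X Y m').symm β⟩).2
    (key ((homologyDigraph_pointsTo_iff ⟨m, α⟩ ⟨m', β⟩).1 hαβ))

end Pointing

end HomologyDigraph

end

theorem mainTheorem1 (K : Type u) [Field K] (X Y : Type u)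
    [TopologicalSpace X] [Preorder X] [TopologicalSpace Y] [Preorder Y] :
    HomologyDigraph.DirectionalSpace.IsIsomorphism
      ((HomologyDigraph.homologyDigraph K X).tensor (HomologyDigraph.homologyDigraph K Y))
      (HomologyDigraph.homologyDigraph K (X × Y))
      (HomologyDigraph.crossProduct K X Y) :=
  ⟨HomologyDigraph.isMorphism_crossProduct, _, HomologyDigraph.isMorphism_totalCrossEquiv_symm,
    fun n => LinearMap.ext (HomologyDigraph.totalCrossEquiv K X Y n).symm_apply_apply,
    fun n => LinearMap.ext (HomologyDigraph.totalCrossEquiv K X Y n).apply_symm_apply⟩
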